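/- **Theorem.** Let $k$ be an algebraically closed field of characteristic $3$, let $G$ be a simple algebraic group of type $F_4$ over $k$, and let $\mathfrak g=\mathrm{Lie}(G)$, that is, $\mathfrak g=\mathfrak g_{\mathbb Z}\otimes_{\mathbb Z}k$ with $\mathfrak g_{\mathbb Z}$ the $\mathbb Z$-span of a Chevalley basis $\{e_\alpha,h_i\}$ of the complex simple Lie algebra of type $F_4$. Let $\mathcal O(\widetilde A_2+A_1)$ be the $G$-orbit of $e_{\alpha_1}+e_{\alpha_3}+e_{\alpha_4}$, where $\alpha_1,\alpha_2$ (long) and $\alpha_3,\alpha_4$ (short) are the simple roots in Bourbaki's numbering. Let $e\in\mathcal O(\widetilde A_2+A_1)$, let $\mathfrak g_e=\{x\in\mathfrak g:[x,e]=0\}$ and $\mathfrak n_e=\{x\in\mathfrak g:[x,e]\in k e\}$ be its centraliser and normaliser, let $A=\mathrm{rad}(\mathfrak g_e)$ be the solvable radical of $\mathfrak g_e$, and let $\mathfrak w=N_{\mathfrak g}(A)=\{x\in\mathfrak g:[x,A]\subseteq A\}$. Then $A$ is abelian of dimension $8$, and (a) $\mathfrak g_e/A\cong H(2;\underline 1)$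 as Lie algebras; (b) $A=\mathrm{rad}(\mathfrak n_e)$ and $\mathfrak n_e/A\cong CH(2;\underline 1)$ as Lie algebras; (c) $A=\mathrm{rad}(\mathfrak w)$ and $\mathfrak w/A\cong W(2;\underline 1)$ as Lie algebras; (d) $\mathfrak w$ is a maximal Lie subalgebra of $\mathfrak g$, and it is not parabolic, i.e. it is not the Lie algebra of a parabolic subgroup of $G$. Here $W(2;\underline 1)=\mathrm{Der}_k\,\mathcal O$ is the Jacobson–Witt algebra of all derivations $f_1\partial_1+f_2\partial_2$ of the truncated polynomial ring $\mathcal O=k[x_1,x_2]/(x_1^3,x_2^3)$, $H(2;\underline 1)$ is the subalgebra of all $f_1\partial_1+f_2\partial_2$ with $\partial_1(f_1)+\partial_2(f_2)=0$, and $CH(2;\underline 1)=H(2;\underline 1)\oplus k(x_1\partial_1+x_2\partial_2)$. -/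

import Mathlib

/-! ## The Lie algebra of type `F₄` over a commutative ring

The Chevalley basis consists of root vectors `e_α` and of `h_i = h_{α_i}`, `i = 1, …, 4`.  The
roots are written in coordinates with respect to the simple roots `α₁, …, α₄` (Bourbaki's
numbering; `α₁, α₂` are long, `α₃, α₄` are short).  The signs of the structure constants are
obtained by folding: the simply laced root system `E₆` has the structure constants
`[E_a, E_b] = ε(a, b) E_{a+b}` for a bimultiplicative sign `ε` which is invariant under the
diagram automorphism, and `e_α` is the sum of the `E_a` over the orbit of roots of `E₆` that
restrict to `α` (with a sign for negative `α`, so that `[e_α, e_{-α}] = h_α`). -/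

namespace F4

/-- Indices of the roots: `inl i` is the `i`-th positive root, `inr i` is its negative. -/
abbrev Root : Type := Fin 24 ⊕ Fin 24

/-- Indices of the Chevalley basis: `inl α` stands for `e_α`, and `inr i` stands for `h_i`. -/
abbrev Idx : Type := Root ⊕ Fin 4

/-- The positive roots, as coefficient vectors with respect to the simple roots. -/
def posRoot : Fin 24 → Fin 4 → ℤ :=
  ![![1, 0, 0, 0], ![0, 1, 0, 0], ![0, 0, 1, 0], ![0, 0, 0, 1],
    ![1, 1, 0, 0], ![0, 1, 1, 0], ![0, 0, 1, 1],
    ![1, 1, 1, 0], ![0, 1, 2, 0], ![0, 1, 1, 1],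
    ![1, 1, 2, 0], ![1, 1, 1, 1], ![0, 1, 2, 1],
    ![1, 2, 2, 0], ![1, 1, 2, 1], ![0, 1, 2, 2],
    ![1, 2, 2, 1], ![1, 1, 2, 2], ![1, 2, 3, 1], ![1, 2, 2, 2],
    ![1, 2, 3, 2], ![1, 2, 4, 2], ![1, 3, 4, 2], ![2, 3, 4, 2]]

/-- The coefficients of a root with respect to the simple roots. -/
def coord : Root → Fin 4 → ℤ
  | .inl i => posRoot i
  | .inr i => -posRoot i

/-- The sign of a root. -/
def sgn : Root → ℤ
  | .inl _ => 1
  | .inr _ => -1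

/-- `⟨α, α_i^∨⟩`, through the Cartan matrix `⟨α_j, α_i^∨⟩ = F₄ j i`. -/
def pairing (α : Root) (i : Fin 4) : ℤ := ∑ j, coord α j * CartanMatrix.F₄ j i

/-- `(α_i | α_i) / 2`, where short roots have square length `2` and long roots `4`. -/
def halfLen : Fin 4 → ℤ := ![2, 2, 1, 1]

/-- `(α | α)`, which is `2` or `4`. -/
def normSq (α : Root) : ℤ := ∑ i, coord α i * halfLen i * pairing α i

/-- The coefficients of `h_α` with respect to `h_1, …, h_4`: as `α^∨ = 2 α / (α | α)`, these are
`coord α i * (α_i | α_i) / (α | α)` (the division is exact). -/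
def coroot (α : Root) (i : Fin 4) : ℤ := coord α i * (2 * halfLen i) / normSq α

/-- A root of `E₆` (coefficients with respect to Bourbaki's simple roots `1, …, 6`) that restricts
to a given root of `F₄`: the nodes `2, 4` restrict to `α₁, α₂`, the nodes `3, 5` to `α₃`, and the
nodes `1, 6` to `α₄`. -/
def lift (v : Fin 4 → ℤ) : Fin 6 → ℤ :=
  ![(v 3 + 1) / 2, v 0, (v 2 + 1) / 2, v 1, v 2 / 2, v 3 / 2]

/-- The diagram automorphism of `E₆`. -/
def flip (a : Fin 6 → ℤ) : Fin 6 → ℤ := ![a 5, a 1, a 4, a 3, a 2, a 0]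

/-- The roots of `E₆` that restrict to a given root of `F₄`: one for a long root, two for a short
root. -/
def orbit (v : Fin 4 → ℤ) : List (Fin 6 → ℤ) :=
  if flip (lift v) = lift v then [lift v] else [lift v, flip (lift v)]

/-- The sign `ε(a, b) = (-1) ^ (∑ i, a_i b_i + ∑ a_i b_j)`, where the second sum is over the edges
`i → j` of the diagram of `E₆` with the orientation `1 → 3 → 4 ← 5 ← 6`, `2 → 4`. -/
def eps (a b : Fin 6 → ℤ) : ℤ :=
  if Even (a 0 * (b 0 + b 2) + a 1 * (b 1 + b 3) + a 2 * (b 2 + b 3) + a 3 * b 3 +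
    a 4 * (b 4 + b 3) + a 5 * (b 5 + b 4)) then 1 else -1

/-- The coefficient of `E_c` in `[∑ E_a, ∑ E_b]`, where `a` and `b` run through the orbits of `u`
and `v`, and `c = lift w`. -/
def foldSum (u v w : Fin 4 → ℤ) : ℤ :=
  ((orbit u).map fun a => ((orbit v).map fun b => if a + b = lift w then eps a b else 0).sum).sum

/-- The structure constant `N_{α,β}` in `[e_α, e_β] = N_{α,β} e_γ`, where `γ = α + β`. -/
def N (α β γ : Root) : ℤ := sgn α * sgn β * sgn γ * foldSum (coord α) (coord β) (coord γ)

/-- The structure constants of the Chevalley basis: `sc i j l` is the coefficient of the `l`-th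
basis vector in the bracket of the `i`-th and the `j`-th one. -/
def sc : Idx → Idx → Idx → ℤ
  | .inl α, .inl β, .inl γ => if coord α + coord β = coord γ then N α β γ else 0
  | .inl α, .inl β, .inr i => if coord α + coord β = 0 then coroot α i else 0
  | .inr i, .inl β, .inl γ => if β = γ then pairing β i else 0
  | .inl α, .inr i, .inl γ => if α = γ then -pairing α i else 0
  | _, _, _ => 0

/-! ### The Jacobi identity

The rest of this namespace verifies that these structure constants define a Lie algebra: the
brackets of basis vectors are tabulated (`sparse`), the table is compared with `sc`, and the Jacobi
identity is checked on the table. -/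

section Jacobi

set_option maxRecDepth 100000

def code : Idx → ℕ
  | .inl (.inl i) => i
  | .inl (.inr i) => 24 + i
  | .inr i => 48 + i

def ofNum (n : ℕ) : Root := if n < 24 then .inl (Fin.ofNat 24 n) else .inr (Fin.ofNat 24 (n - 24))

def opp : Root → Root
  | .inl i => .inr i
  | .inr i => .inl i

def tbl : ℕ := 0x162acd5292009c8025a008d45615057e3c9d8006cb5000000000000a44ea491a003e800d2002e14498411d0d054000e848000000000000000002d200aed480144004c801228e4461901003c800e56e3459a00000015a004ca500082001d000642d1549445000d000210d0541200000000000005cad800ad0029942004d25400004521400003d1d4e20035192c4002d154004e0011484001c8d800001489800000c85824000481a02000000000bd5d000000000294009e4c801248d44a19047d001d8e20000198c15e2c800000000118003d1d000622e15094421e000542400000140500000017c00000000000000000000000000000000000000000000000000000003b09c8fa8a4725532005129800a95680000b2000016a00000017400002e97200000000000000000000000000000000000000000000000000017c0101d94ec81428012496002754200002a95c00002c40000002d800005b6d40000000000000000000000000000000000000000000017a00002e800120280ed4003ca0800894880134004f0014a005500000005880000b20000000000000000000000000000000000000000000be802e200005a400001d0b028076a371d8f27d428011c9100268009ed129200a9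5640000aed66b800000000000000000000000000000005e801740000000000058800002a10800140380198dc71000000085002380000000013ca10029400a95500000000000000000000000000000000bc802ea00005b40000b100000002e128641c0001c00d4003b1e4fa80c2a2b1c924b66400005080000a6802954c00000000000000000000002f80000000016a00002c40000002b40035000882c060000e006237000007a000000000468000099000013a0050a8800000000000000000000005f40171000000000005900000acd4800003919000320e050000700335b8e175001f8008500239249480264009e800013a00000000000000000000002e400005b00000b2000015c00000014a001b0a43a1100008000380000dc00001e800004280000910000000004d2653400000000000000017900000016d00002c80000002a400a4802840042000c44a000b0380d0001c00c56a37000007a3e8000088c68012294802580000000000000002f400ba0000000000000000005500000a10000000461e80000000c8001c000000e000033000e275001f904000022400004900122000000000000000175005a40000b10000000aa00001449c800013200208e85c000e800210e014000700001a8dc003a9e80080c2800008e468011c000000000005f4000000000016400002bb54005268800004c8000049000006225104682a000500000038018a006e38400f47d000010a88c562514000000000be0000000b5000000000002a8000000000009900254004d000f8000012800000007018000001c00c46a0000000003e801028642a190a000000000005c40000005880000acd480000a14e4000000488011a0025000742e154003c1a0000014028000e0000325b80075001e80080c140102000000000b9002d800000000000a9000000000000012c91000011200271140000170000000000441c0001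0000700001a800003a800007d00000fc000000179000000000b10000152000028800004ca5a008d444000052000007d00190004a000d054000e0500000038018ad40038400ea7a3d1e400000000000005a4016200002a400a68027a009a002491c000021800000012884001b4b400250e8002a1080012000001c000069370000075001d8ea00000017500002c800005500000a1000000094c8800008540400fa002880089001c8005c000007834000003814028000e0000325a80000385c8e400002f800000000000ad000014200000012a004680000003e800005500000003e00000640000088001a00000000a00000070000188ca6eb68000000000000000590015d00536893d004d001248e0021800003d0000000000009241000e4693114400411d000540000048000003800000069355a40000000016db200001540000000009a00248008a8020afc79001d80000001449900208000000168004a000e8002a1087012000001c0000003259aca00002e40000002b800005100000004b00000004280000003a800e2002b0000045000007200000a400000006800000002804000000e000000184c5005e80000000000000a6000013400002391400001f80000001c8005a000000000000f40000188000025108000015000000a0000000070000000ba03810443c29168d8740020914004a27000005100000ac0000000b20000000000000000000000000000000000000000000000000000000000164b46201c182a22130006235000f88400001249a0000148000000154000000000000000000000000000000000000000000000000000000ba002a55800713300e12000d084002a1900072001e8008c0024800000029000000000000000000000000000000000000000000000000bc0000164005100000007e3a9a4070906854341e130005a32000e4003ca091a004a27400000000000000000000000000000000000000005c8016a00002b4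00004ca7534008941000d203800141a12000000026000b40000000007a420011800000000000000000000000000000002f000b20000000000029000004a24800008d431e8da0001c0012000a8683c22930a25a311a4e8000021000000000000000000000000000000005e8016200002a4000052000000044801188a9600204ea650000e000106800001900000000017000003a000007c0000000000000000000000174000000000ac0000148000000138000021104009a48800f46d348000700024342516000740026000b46236800e800000000000000000000002e400b50000000000028800004ea5000003c800007c004aa28fc72001840003800001a000006400001300000320000000000000000000000000000016800002a8000051000009a00000008c001c8e872a1002490c003a9b4c90001c0001090680000190f000002a97000640000000000000000bd0000000a900001440000001280046801080036800d400a54f00000003d000da000000e0000028002416000744200000a80000000000000001780059000000000000000000248000042000000000188006400512651a003f000e56d304000700000241a000b064002293000000000000000000000b1002b400005200000004900000823e80000742d170005aaa000012486415e4ec0034800000380002000d09400321e000004c000000000002e400000000000a2000013292002350400001d000002a944a852ae00274000043000000036994000001c0002090000000000f000440000000005d00000005600000000000124000000000003a000d80025130944c0054801328d44400fa7900000d2608000e00000343400160006400000000000002d400000029000004ea500000421f4000000190005c2290400440056a980000468000000001c8da003080007000002400000b000000000000005a00154000000000004a000000000000006a3200000541e000003ab1000013900488010c003c9d8006d3480000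03800021200094002c0000000bd000000000520000094000010400001d0d2002e1540000190c8680000002a542004a63800863f000ec728019a000001c00000a0680000000000000002b400a400001280044800f20039000c45a00000940016000542c00590014d004d0011a00001f4f200001b4d2608000e000003424000000000b100001440000248000042000000036990000026114003c000944422b600000009d000012200002040079000000069000000700000040c0000174000000000004e000008400000006c001700000000f000000c8700000000000154a2002692d9245401057e001d800003500000038000000000000000002880099002250479001c800622d0009400000c800000a044280000002c95d00510000000470010c003f000ec72b699a000001c00000000000a951000009200000000039000c40028800823a1a000540000034120c005a80000a6000013400002280000001e40000001a4c2000000e00000016800000013400002080000001a80000001300000000b00024000000801b900000000000278000049000008641000007600000cc000000007002f0000000000000045000007200000b452000007400000004400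

def ctbl : ℕ := 0x65456546655654356656643566666535666765557656655766557666665776677655667776577766677776777767777689a989a889989ab988988ab9888889b98887899978988997889978888897788778998877789777888777787777877778

def rtbl : ℕ := 0x201220132023212322233123223332232234323342233234333342333334423443333344433444333444434444344443687668756865676566655765665556656654565546655654555546555554465445555544455444555444454444544445

def rmask : ℕ := 0xa0040102408b142d0a22c8442688a16851a2048100400a000000000000000000000000000

/-- The nonzero coefficients of the bracket of two basis vectors. -/
def sparse (i j : ℕ) : List (ℕ × ℤ) :=
  (fun e : ℕ =>
    bif Nat.beq e 0 then []
    else bif Nat.beq e 7 then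
      (List.range 4).map fun q => (Nat.add 48 q,
        Int.subNatNat (Nat.mod (Nat.shiftRight ctbl (Nat.mul 4 (Nat.add (Nat.mul 4 i) q))) 16) 7)
    else [(Nat.div e 8, Int.subNatNat (Nat.mod e 8) 3)])
  (Nat.mod (Nat.shiftRight tbl (Nat.mul 9 (Nat.add (Nat.mul 52 i) j))) 512)

def coef (v : List (ℕ × ℤ)) (l : ℕ) : ℤ := (v.map fun t => if t.1 = l then t.2 else 0).sum

def func (v : Fin 4 → ℤ) : ℤ := 2 * v 0 - 33 * v 1 - 7 * v 2 + 17 * v 3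

theorem func_inj : ∀ α β : Root, func (coord α) = func (coord β) → α = β := by decide +kernel

theorem func_mask : ∀ α : Root,
    Nat.testBit rmask (Int.toNat (func (coord α) + 200)) = true := by
  decide +kernel

theorem coord_ne : ∀ α : Root, coord α ≠ 0 := by decide +kernel

def digit (n : ℕ) (i : Fin 4) : ℤ :=
  Int.subNatNat (Nat.mod (Nat.shiftRight rtbl (Nat.mul 4 (Nat.add (Nat.mul 4 n) i.1))) 16) 4

theorem coord_eq : ∀ α : Root, coord α = digit (code (.inl α)) := by decide +kernel

def pairOK (i j : ℕ) : Bool :=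
  bif Nat.beq i (Nat.mod (Nat.add j 24) 48) then true
  else bif Nat.testBit rmask (Int.toNat (func (digit i) + func (digit j) + 200)) then
    (fun n : ℕ => decide (n < 48) && (decide (digit i + digit j = digit n) &&
      decide (sparse i j = [(n, sgn (ofNum i) * sgn (ofNum j) * sgn (ofNum n) *
        foldSum (digit i) (digit j) (digit n))])))
      (Nat.div (Nat.mod (Nat.shiftRight tbl (Nat.mul 9 (Nat.add (Nat.mul 52 i) j))) 512) 8)
  else decide (sparse i j = [])

theorem pairs_ok :
    ((List.range 48).all fun i => (List.range 48).all fun j => pairOK i j) = true := by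
  decide +kernel

theorem sparse_opp : ∀ β : Root, sparse (code (.inl (opp β))) (code (.inl β)) =
    [(48, coroot (opp β) 0), (49, coroot (opp β) 1), (50, coroot (opp β) 2),
      (51, coroot (opp β) 3)] := by
  decide +kernel

theorem sparse_tr : ∀ β : Root, ∀ i : Fin 4, sparse (code (.inr i)) (code (.inl β)) =
    if pairing β i = 0 then [] else [(code (.inl β), pairing β i)] := by
  decide +kernel

theorem sparse_rt : ∀ β : Root, ∀ i : Fin 4, sparse (code (.inl β)) (code (.inr i)) =
    if pairing β i = 0 then [] else [(code (.inl β), -pairing β i)] := by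
  decide +kernel

theorem sparse_tt : ∀ i j : Fin 4, sparse (code (.inr i)) (code (.inr j)) = [] := by
  decide +kernel

theorem sparse_anti :
    ((List.range 52).all fun i => (List.range 52).all fun j =>
      decide (sparse i j = (sparse j i).map fun t => (t.1, Int.neg t.2)) &&
        (sparse i j).all fun t => Nat.blt t.1 52) = true := by
  decide +kernel

theorem code_lt : ∀ a : Idx, code a < 52 := by decide +kernel

theorem code_surj : ∀ n < 52, ∃ a : Idx, code a = n := by decide +kernel

theorem code_inj {a b : Idx} (h : code a = code b) : a = b := by
  rcases a with (a | a) | a <;> rcases b with (b | b) | b <;> simp only [code] at h <;>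
    first
      | (have := a.2; have := b.2; omega)
      | (congr 2; omega)

theorem ofNum_code : ∀ α : Root, ofNum (code (.inl α)) = α := by decide +kernel

theorem code_ofNum : ∀ n < 48, code (.inl (ofNum n)) = n := by decide +kernel

theorem code_opp : ∀ α β : Root,
    Nat.beq (code (.inl α)) (Nat.mod (Nat.add (code (.inl β)) 24) 48) = true → α = opp β := by
  decide +kernel

theorem coord_opp (β : Root) : coord (opp β) = -coord β := by
  rcases β with β | β <;> simp [opp, coord]

theorem coord_inj {α β : Root} (h : coord α = coord β) : α = β :=
  func_inj α β (by rw [h])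

theorem func_add (u v : Fin 4 → ℤ) : func (u + v) = func u + func v := by
  simp only [func, Pi.add_apply]; ring

theorem code_root_lt (α : Root) : code (.inl α) < 48 := by
  rcases α with a | a <;> simp only [code] <;> omega

theorem sc_root_root (α β : Root) (c : Idx) :
    sc (.inl α) (.inl β) c = coef (sparse (code (.inl α)) (code (.inl β))) (code c) := by
  by_cases hab : α = opp β
  · subst hab
    rw [sparse_opp]
    rcases c with γ | i
    · have h1 : coord (opp β) + coord β ≠ coord γ := by
        rw [coord_opp, neg_add_cancel]; exact (coord_ne γ).symm
      have h2 := code_root_lt γ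
      simp only [sc, if_neg h1, coef, List.map_cons, List.map_nil, List.sum_cons, List.sum_nil]
      rw [if_neg (by omega), if_neg (by omega), if_neg (by omega), if_neg (by omega)]
      rfl
    · have h1 : coord (opp β) + coord β = 0 := by rw [coord_opp, neg_add_cancel]
      simp only [sc, if_pos h1]
      fin_cases i <;> simp [coef, code]
  · have hne : coord α + coord β ≠ 0 := fun h => hab (coord_inj (by
      rw [coord_opp]; exact eq_neg_of_add_eq_zero_left h))
    have hp := List.all_eq_true.1 (List.all_eq_true.1 pairs_ok _
      (List.mem_range.2 (code_root_lt α))) _ (List.mem_range.2 (code_root_lt β))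
    have hb : Nat.beq (code (.inl α)) (Nat.mod (Nat.add (code (.inl β)) 24) 48) = false := by
      by_contra h
      exact hab (code_opp α β (by simpa using h))
    simp only [pairOK, hb, cond_false] at hp
    rw [← coord_eq, ← coord_eq] at hp
    by_cases hm : Nat.testBit rmask (Int.toNat (func (coord α) + func (coord β) + 200)) = true
    · rw [hm, cond_true] at hp
      generalize (Nat.div (Nat.mod (Nat.shiftRight tbl
        (Nat.mul 9 (Nat.add (Nat.mul 52 (code (.inl α))) (code (.inl β))))) 512) 8) = n at hp
      simp only [Bool.and_eq_true, decide_eq_true_eq] at hp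
      obtain ⟨hn, hs, hv⟩ := hp
      rw [← code_ofNum n hn, ← coord_eq, ofNum_code, ofNum_code, ofNum_code] at hv
      rw [← code_ofNum n hn, ← coord_eq] at hs
      rw [hv]
      generalize ofNum n = δ at hs
      rcases c with γ | i
      · by_cases hg : γ = δ
        · subst hg
          simp [sc, hs, coef, N]
        · have h1 : coord α + coord β ≠ coord γ := fun h => hg (coord_inj (h.symm.trans hs))
          have h2 : code (.inl δ) ≠ code (.inl γ) := fun h =>
            hg (Sum.inl_injective (code_inj h)).symm
          simp [sc, h1, h2, coef]
      · have h2 := code_root_lt δ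
        have h3 : code (.inl δ) ≠ code (.inr i) := by simp only [code] at h2 ⊢; omega
        simp [sc, hne, h3, coef]
    · rw [Bool.not_eq_true] at hm
      rw [hm, cond_false, decide_eq_true_eq] at hp
      rw [hp]
      rcases c with γ | i
      · have h1 : coord α + coord β ≠ coord γ := fun h => by
          have := func_mask γ
          rw [← h, func_add, hm] at this
          exact Bool.noConfusion this
        simp [sc, h1, coef]
      · simp [sc, hne, coef]

theorem sc_eq (a b c : Idx) : sc a b c = coef (sparse (code a) (code b)) (code c) := by
  rcases a with α | i <;> rcases b with β | j
  · exact sc_root_root α β c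
  · rw [sparse_rt]
    rcases c with γ | l
    · by_cases hg : α = γ
      · subst hg
        by_cases h0 : pairing α j = 0 <;> simp [sc, coef, h0]
      · have h2 : code (.inl α) ≠ code (.inl γ) := fun h => hg (Sum.inl_injective (code_inj h))
        by_cases h0 : pairing α j = 0 <;> simp [sc, coef, h0, hg, h2]
    · have h2 := code_root_lt α
      have h3 : code (.inl α) ≠ code (.inr l) := by simp only [code] at h2 ⊢; omega
      by_cases h0 : pairing α j = 0 <;> simp [sc, coef, h0, h3]
  · rw [sparse_tr]
    rcases c with γ | l
    · by_cases hg : β = γ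
      · subst hg
        by_cases h0 : pairing β i = 0 <;> simp [sc, coef, h0]
      · have h2 : code (.inl β) ≠ code (.inl γ) := fun h => hg (Sum.inl_injective (code_inj h))
        by_cases h0 : pairing β i = 0 <;> simp [sc, coef, h0, hg, h2]
    · have h2 := code_root_lt β
      have h3 : code (.inl β) ≠ code (.inr l) := by simp only [code] at h2 ⊢; omega
      by_cases h0 : pairing β i = 0 <;> simp [sc, coef, h0, h3]
  · rw [sparse_tt]
    rcases c with γ | l <;> simp [sc, coef]

theorem coef_neg (v : List (ℕ × ℤ)) (l : ℕ) :
    coef (v.map fun t => (t.1, Int.neg t.2)) l = -coef v l := by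
  induction v with
  | nil => simp [coef]
  | cons t v ih =>
    simp only [coef, List.map_cons, List.sum_cons] at ih ⊢
    rw [ih]
    by_cases h : t.1 = l
    · simp only [h, if_true, neg_add]; rfl
    · simp only [h, if_false, neg_add, neg_zero]

theorem sc_anti (a b c : Idx) : sc a b c = -sc b a c := by
  have h := List.all_eq_true.1 (List.all_eq_true.1 sparse_anti _
    (List.mem_range.2 (code_lt a))) _ (List.mem_range.2 (code_lt b))
  rw [Bool.and_eq_true, decide_eq_true_eq] at h
  rw [sc_eq, sc_eq, h.1, coef_neg]

theorem sc_self (a c : Idx) : sc a a c = 0 := by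
  have := sc_anti a a c
  omega

def ins (l : ℕ) (c : ℤ) (r : List (ℕ × ℤ)) : List (ℕ × ℤ) :=
  match c with
  | .ofNat 0 => r
  | c => (l, c) :: r

def dbl (i j k : ℕ) (r : List (ℕ × ℤ)) : List (ℕ × ℤ) :=
  (sparse j k).foldr
    (fun t r => (sparse i t.1).foldr (fun s r => ins s.1 (Int.mul t.2 s.2) r) r) r

def jac (i j k : ℕ) : List (ℕ × ℤ) := dbl i j k (dbl j k i (dbl k i j []))

def allZero (v : List (ℕ × ℤ)) : Bool :=
  match v with
  | [] => true
  | v => v.all fun t => decide (coef v t.1 = 0)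

theorem jac_ok : ((List.range 52).all fun i => (List.range i).all fun j => (List.range j).all
    fun k => allZero (jac i j k)) = true := by
  decide +kernel

theorem coef_of_allZero {v : List (ℕ × ℤ)} (h : allZero v = true) (l : ℕ) : coef v l = 0 := by
  have h' : v.all (fun t => decide (coef v t.1 = 0)) = true := by
    cases v with
    | nil => rfl
    | cons t v => exact h
  by_cases hl : ∃ t ∈ v, t.1 = l
  · obtain ⟨t, ht, rfl⟩ := hl
    simpa using List.all_eq_true.1 h' t ht
  · push Not at hl
    unfold coef
    apply List.sum_eq_zero
    intro x hx
    obtain ⟨t, ht, rfl⟩ := List.mem_map.1 hx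
    exact if_neg (hl t ht)

theorem coef_ins (n : ℕ) (c : ℤ) (r : List (ℕ × ℤ)) (l : ℕ) :
    coef (ins n c r) l = (if n = l then c else 0) + coef r l := by
  unfold ins
  split
  · simp
  · simp [coef]

theorem coef_dbl (i j k : ℕ) (r : List (ℕ × ℤ)) (l : ℕ) :
    coef (dbl i j k r) l =
      ((sparse j k).map fun t => t.2 * coef (sparse i t.1) l).sum + coef r l := by
  have inner : ∀ (c : ℤ) (w r : List (ℕ × ℤ)),
      coef (w.foldr (fun s r => ins s.1 (Int.mul c s.2) r) r) l = c * coef w l + coef r l := by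
    intro c w r
    induction w with
    | nil => simp [coef]
    | cons s w ih =>
      rw [List.foldr_cons, coef_ins, ih]
      simp only [coef, List.map_cons, List.sum_cons, mul_add]
      by_cases h : s.1 = l
      · simp only [h, if_true]
        rw [show Int.mul c s.2 = c * s.2 from rfl]; ring
      · simp [h]
  unfold dbl
  induction sparse j k with
  | nil => simp
  | cons t v ih =>
    rw [List.foldr_cons, inner, ih, List.map_cons, List.sum_cons]
    ring

/-- The `l`-th coefficient of `[b_i, [b_j, b_k]]`. -/
def sc₂ (i j k l : Idx) : ℤ := ∑ m, sc j k m * sc i m l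

theorem sum_coef (F : ℕ → ℤ) (v : List (ℕ × ℤ)) (hv : ∀ t ∈ v, t.1 < 52) :
    ∑ m : Idx, coef v (code m) * F (code m) = (v.map fun t => t.2 * F t.1).sum := by
  induction v with
  | nil => simp [coef]
  | cons t v ih =>
    have h1 : ∀ m : Idx, coef (t :: v) (code m) * F (code m) =
        (if t.1 = code m then t.2 else 0) * F (code m) + coef v (code m) * F (code m) := by
      intro m; simp [coef, add_mul]
    rw [Finset.sum_congr rfl fun m _ => h1 m, Finset.sum_add_distrib,
      ih fun s hs => hv s (List.mem_cons_of_mem _ hs), List.map_cons, List.sum_cons]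
    congr 1
    obtain ⟨a, ha⟩ := code_surj t.1 (hv t List.mem_cons_self)
    rw [Finset.sum_eq_single a]
    · rw [ha, if_pos rfl]
    · intro b _ hb
      rw [if_neg, zero_mul]
      intro h
      exact hb (code_inj (h.symm.trans ha.symm))
    · simp

theorem sc₂_eq (i j k l : Idx) : sc₂ i j k l =
    ((sparse (code j) (code k)).map fun t => t.2 * coef (sparse (code i) t.1) (code l)).sum := by
  unfold sc₂
  have h := List.all_eq_true.1 (List.all_eq_true.1 sparse_anti _
    (List.mem_range.2 (code_lt j))) _ (List.mem_range.2 (code_lt k))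
  rw [Bool.and_eq_true] at h
  rw [← sum_coef (fun n => coef (sparse (code i) n) (code l))]
  · exact Finset.sum_congr rfl fun m _ => by rw [sc_eq, sc_eq]
  · intro t ht
    simpa [Nat.blt_eq] using List.all_eq_true.1 h.2 t ht

theorem sc₂_swap (i j k l : Idx) : sc₂ i j k l = -sc₂ i k j l := by
  unfold sc₂
  rw [← Finset.sum_neg_distrib]
  exact Finset.sum_congr rfl fun m _ => by rw [sc_anti j k m, neg_mul]

theorem jacobi_aux (i j k l : Idx) (h₁ : code j < code i) (h₂ : code k < code j) :
    sc₂ i j k l + sc₂ j k i l + sc₂ k i j l = 0 := by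
  have h := List.all_eq_true.1 (List.all_eq_true.1 (List.all_eq_true.1 jac_ok _
    (List.mem_range.2 (code_lt i))) _ (List.mem_range.2 h₁)) _ (List.mem_range.2 h₂)
  have h' := coef_of_allZero h (code l)
  unfold jac at h'
  rw [coef_dbl, coef_dbl, coef_dbl, ← sc₂_eq, ← sc₂_eq, ← sc₂_eq] at h'
  simp only [coef, List.map_nil, List.sum_nil, add_zero] at h'
  linarith

theorem jacobi (i j k l : Idx) : sc₂ i j k l + sc₂ j k i l + sc₂ k i j l = 0 := by
  have s := sc₂_swap
  rcases lt_trichotomy (code i) (code j) with h₁ | h₁ | h₁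
  · rcases lt_trichotomy (code j) (code k) with h₂ | h₂ | h₂
    · linarith [jacobi_aux k j i l h₂ h₁, s i j k l, s j k i l, s k i j l]
    · obtain rfl := code_inj h₂
      linarith [s i j j l, s j j i l]
    · rcases lt_trichotomy (code i) (code k) with h₃ | h₃ | h₃
      · linarith [jacobi_aux j k i l h₂ h₃]
      · obtain rfl := code_inj h₃
        linarith [s i j i l, s j i i l]
      · linarith [jacobi_aux j i k l h₁ h₃, s i j k l, s j k i l, s k i j l]
  · obtain rfl := code_inj h₁
    linarith [s i i k l, s k i i l]
  · rcases lt_trichotomy (code j) (code k) with h₂ | h₂ | h₂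
    · rcases lt_trichotomy (code i) (code k) with h₃ | h₃ | h₃
      · linarith [jacobi_aux k i j l h₃ h₁]
      · obtain rfl := code_inj h₃
        linarith [s i j i l, s j i i l]
      · linarith [jacobi_aux i k j l h₃ h₂, s i j k l, s j k i l, s k i j l]
    · obtain rfl := code_inj h₂
      linarith [s i j j l, s j j i l]
    · exact jacobi_aux i j k l h₁ h₂

end Jacobi

end F4

/-- The Lie algebra of type `F₄` over `R`: the base change to `R` of the `ℤ`-span of a Chevalley
basis, that is, the free module on the Chevalley basis with the structure constants `F4.sc` mapped
to `R`.  An element is given by its coefficients. -/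
def LieF4 (R : Type*) : Type _ := F4.Idx → R

namespace LieF4

section

variable {R : Type*} [CommRing R]

instance : AddCommGroup (LieF4 R) := inferInstanceAs (AddCommGroup (F4.Idx → R))

instance : Module R (LieF4 R) := inferInstanceAs (Module R (F4.Idx → R))

instance : Bracket (LieF4 R) (LieF4 R) where
  bracket x y := fun l => ∑ i, ∑ j, x i * y j * (F4.sc i j l : R)

@[ext]
theorem ext {R : Type*} {x y : LieF4 R} (h : ∀ l, x l = y l) : x = y := funext h

theorem add_apply (x y : LieF4 R) (l : F4.Idx) : (x + y) l = x l + y l := rfl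

theorem smul_apply (t : R) (x : LieF4 R) (l : F4.Idx) : (t • x) l = t * x l := rfl

theorem zero_apply (l : F4.Idx) : (0 : LieF4 R) l = 0 := rfl

theorem lie_apply (x y : LieF4 R) (l : F4.Idx) :
    ⁅x, y⁆ l = ∑ i, ∑ j, x i * y j * (F4.sc i j l : R) := rfl

theorem lie_lie_apply (x y z : LieF4 R) (l : F4.Idx) :
    ⁅x, ⁅y, z⁆⁆ l = ∑ i, ∑ j, ∑ k, x i * y j * z k * (F4.sc₂ i j k l : R) := by
  simp only [lie_apply, F4.sc₂, Int.cast_sum, Int.cast_mul, Finset.mul_sum, Finset.sum_mul]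
  refine Finset.sum_congr rfl fun i _ => ?_
  rw [Finset.sum_comm]
  refine Finset.sum_congr rfl fun j _ => ?_
  rw [Finset.sum_comm]
  refine Finset.sum_congr rfl fun k _ => Finset.sum_congr rfl fun m _ => ?_
  ring

theorem jacobi_sum (x y z : LieF4 R) : ⁅x, ⁅y, z⁆⁆ + ⁅y, ⁅z, x⁆⁆ + ⁅z, ⁅x, y⁆⁆ = 0 := by
  ext l
  rw [add_apply, add_apply, zero_apply, lie_lie_apply, lie_lie_apply, lie_lie_apply]
  have h₂ : ∑ i, ∑ j, ∑ k, y i * z j * x k * (F4.sc₂ i j k l : R) =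
      ∑ i, ∑ j, ∑ k, x i * y j * z k * (F4.sc₂ j k i l : R) := by
    rw [Finset.sum_congr rfl fun i _ => Finset.sum_comm, Finset.sum_comm]
    refine Finset.sum_congr rfl fun i _ => Finset.sum_congr rfl fun j _ =>
      Finset.sum_congr rfl fun k _ => ?_
    ring
  have h₃ : ∑ i, ∑ j, ∑ k, z i * x j * y k * (F4.sc₂ i j k l : R) =
      ∑ i, ∑ j, ∑ k, x i * y j * z k * (F4.sc₂ k i j l : R) := by
    rw [Finset.sum_comm, Finset.sum_congr rfl fun i _ => Finset.sum_comm]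
    refine Finset.sum_congr rfl fun i _ => Finset.sum_congr rfl fun j _ =>
      Finset.sum_congr rfl fun k _ => ?_
    ring
  rw [h₂, h₃]
  simp only [← Finset.sum_add_distrib]
  refine Finset.sum_eq_zero fun i _ => Finset.sum_eq_zero fun j _ =>
    Finset.sum_eq_zero fun k _ => ?_
  rw [← mul_add, ← mul_add, ← Int.cast_add, ← Int.cast_add, F4.jacobi, Int.cast_zero, mul_zero]

theorem lie_swap (x y : LieF4 R) : ⁅x, y⁆ = -⁅y, x⁆ := by
  rw [eq_neg_iff_add_eq_zero]
  ext l
  rw [add_apply, zero_apply, lie_apply, lie_apply, Finset.sum_comm, ← Finset.sum_add_distrib]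
  refine Finset.sum_eq_zero fun i _ => ?_
  rw [← Finset.sum_add_distrib]
  refine Finset.sum_eq_zero fun j _ => ?_
  rw [F4.sc_anti j i l, Int.cast_neg]
  ring

theorem lie_self' (x : LieF4 R) : ⁅x, x⁆ = 0 := by
  ext l
  rw [lie_apply, zero_apply]
  refine (Finset.sum_product' Finset.univ Finset.univ
    fun i j => x i * x j * (F4.sc i j l : R)).symm.trans ?_
  refine Finset.sum_involution (fun a _ => (a.2, a.1)) ?_ ?_ ?_ ?_
  · rintro ⟨i, j⟩ _
    simp only
    rw [F4.sc_anti j i l, Int.cast_neg]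
    ring
  · rintro ⟨i, j⟩ _ h h'
    have h₁ : j = i := (Prod.mk.inj h').1
    subst h₁
    exact h (by simp [F4.sc_self])
  · simp
  · simp

theorem lie_add' (x y z : LieF4 R) : ⁅x, y + z⁆ = ⁅x, y⁆ + ⁅x, z⁆ := by
  ext l
  simp only [lie_apply, add_apply, mul_add, add_mul, Finset.sum_add_distrib]

theorem neg_lie' (x y : LieF4 R) : ⁅-x, y⁆ = -⁅x, y⁆ := by
  have h : ∀ (u : LieF4 R) (i : F4.Idx), (-u) i = -u i := fun _ _ => rfl
  ext l
  simp only [lie_apply, h, neg_mul, Finset.sum_neg_distrib]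

instance : LieRing (LieF4 R) where
  add_lie x y z := by
    rw [lie_swap, lie_add', neg_add, ← lie_swap, ← lie_swap]
  lie_add := lie_add'
  lie_self := lie_self'
  leibniz_lie x y z := by
    have h := jacobi_sum x y z
    have h₁ : ⁅z, ⁅x, y⁆⁆ = -⁅⁅x, y⁆, z⁆ := lie_swap _ _
    have h₂ : ⁅y, ⁅z, x⁆⁆ = -⁅y, ⁅x, z⁆⁆ := by
      rw [lie_swap y, lie_swap z x, neg_lie', neg_neg, lie_swap y, neg_neg]
    rw [h₁, h₂] at h
    rw [add_assoc, ← neg_add, ← sub_eq_add_neg, sub_eq_zero] at h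
    rw [h, add_comm]

instance : LieAlgebra R (LieF4 R) where
  lie_smul t x y := by
    ext l
    simp only [lie_apply, smul_apply, Finset.mul_sum]
    refine Finset.sum_congr rfl fun i _ => Finset.sum_congr rfl fun j _ => ?_
    ring

end

/-- The root vector `e_α`. -/
def rootVec (R : Type*) [CommRing R] (α : F4.Root) : LieF4 R :=
  (Pi.single (Sum.inl α) 1 : F4.Idx → R)

/-- The element `h_i` of the Chevalley basis. -/
def torVec (R : Type*) [CommRing R] (i : Fin 4) : LieF4 R :=
  (Pi.single (Sum.inr i) 1 : F4.Idx → R)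

end LieF4

/-! ## The group `G`, the nilpotent orbit, and parabolic subalgebras -/

namespace LieF4

/-- The Chevalley group of type `F₄` over `k` in its adjoint action on the Lie algebra: it is
generated by the root elements `x_α(t) = exp(t ad e_α)`.  As `(ad e_α)³ = 0`, the exponential is
`1 + t ad e_α + t² (ad e_α)² / 2`; the field is meant to be of characteristic other than two. -/
def chevalleyGroup (k : Type*) [Field k] : Subgroup (LieF4 k ≃ₗ[k] LieF4 k) :=
  Subgroup.closure {φ | ∃ (α : F4.Root) (t : k), ∀ x : LieF4 k,
    φ x = x + t • ⁅rootVec k α, x⁆ + (t ^ 2 / 2) • ⁅rootVec k α, ⁅rootVec k α, x⁆⁆}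

/-- The representative `e_{1000} + e_{0010} + e_{0001}` of the orbit `Ã₂ + A₁`: a sum of root
vectors for the simple roots of a Levi subsystem of type `A₁` (long) plus `Ã₂` (short). -/
def nilpRep (k : Type*) [Field k] : LieF4 k :=
  rootVec k (.inl 0) + rootVec k (.inl 2) + rootVec k (.inl 3)

/-- The nilpotent orbit `Ã₂ + A₁`. -/
def orbitA2tA1 (k : Type*) [Field k] : Set (LieF4 k) :=
  {e | ∃ g ∈ chevalleyGroup k, g (nilpRep k) = e}

/-- The standard parabolic subalgebra of the set `J` of simple roots: it is spanned by the `h_i`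
and by the `e_α` for all positive roots `α` and all roots `α` in the span of `J`. -/
def stdParabolic (k : Type*) [Field k] (J : Set (Fin 4)) : Submodule k (LieF4 k) :=
  Submodule.span k (Set.range (torVec k) ∪
    {x | ∃ α : F4.Root, (∀ i, i ∉ J → 0 ≤ F4.coord α i) ∧ x = rootVec k α})

/-- A parabolic subalgebra is the Lie algebra of a parabolic subgroup of `G`, that is, a conjugate
of a standard one under `G`. -/
def IsParabolic {k : Type*} [Field k] (S : LieSubalgebra k (LieF4 k)) : Prop :=
  ∃ g ∈ chevalleyGroup k, ∃ J : Set (Fin 4),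
    S.toSubmodule = (stdParabolic k J).map (g : LieF4 k →ₗ[k] LieF4 k)

end LieF4

/-! ## Centralisers, normalisers and radicals -/

section LieGeneral

/-- The centraliser of an element. -/
def centralizerOf (k : Type*) {L : Type*} [Field k] [LieRing L] [LieAlgebra k L] (e : L) :
    LieSubalgebra k L where
  carrier := {x | ⁅x, e⁆ = 0}
  add_mem' {x y} hx hy := by
    change ⁅x, e⁆ = 0 at hx
    change ⁅y, e⁆ = 0 at hy
    change ⁅x + y, e⁆ = 0
    rw [add_lie, hx, hy, add_zero]
  zero_mem' := zero_lie e
  smul_mem' c x hx := by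
    change ⁅x, e⁆ = 0 at hx
    change ⁅c • x, e⁆ = 0
    rw [smul_lie, hx, smul_zero]
  lie_mem' {x y} hx hy := by
    change ⁅x, e⁆ = 0 at hx
    change ⁅y, e⁆ = 0 at hy
    change ⁅⁅x, y⁆, e⁆ = 0
    rw [lie_lie, hx, hy, lie_zero, lie_zero, sub_zero]

variable {k L : Type*} [Field k] [LieRing L] [LieAlgebra k L]

/-- The normaliser `{x | [x, V] ⊆ V}` of a subspace. -/
def normalizerOf (V : Submodule k L) : LieSubalgebra k L where
  carrier := {x | ∀ v ∈ V, ⁅x, v⁆ ∈ V}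
  add_mem' {x y} hx hy v hv := by
    rw [add_lie]; exact V.add_mem (hx v hv) (hy v hv)
  zero_mem' v _ := by rw [zero_lie]; exact V.zero_mem
  smul_mem' c x hx v hv := by
    rw [smul_lie]; exact V.smul_mem c (hx v hv)
  lie_mem' {x y} hx hy v hv := by
    rw [lie_lie]
    exact V.sub_mem (hx _ (hy v hv)) (hy _ (hx v hv))

/-- The (solvable) radical of a Lie subalgebra, as a subspace of the ambient Lie algebra. -/
def radicalOf (S : LieSubalgebra k L) : Submodule k L :=
  (LieAlgebra.radical k S).toSubmodule.map (S.incl : S →ₗ[k] L)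

end LieGeneral

/-! ## The Lie algebras `W(m; 1)`, `H(2; 1)` and `CH(2; 1)` -/

/-- The ideal `(x_1^p, …, x_m^p)`. -/
noncomputable def truncIdeal (p m : ℕ) (k : Type*) [CommRing k] : Ideal (MvPolynomial (Fin m) k) :=
  Ideal.span (Set.range fun i => MvPolynomial.X i ^ p)

/-- The truncated polynomial ring `O(m; 1) = k[x_1, …, x_m] / (x_1^p, …, x_m^p)`. -/
abbrev TruncPoly (p m : ℕ) (k : Type*) [CommRing k] : Type _ :=
  MvPolynomial (Fin m) k ⧸ truncIdeal p m k

/-- The Jacobson–Witt algebra `W(m; 1)` of all derivations `∑ f_i ∂_i` of `O(m; 1)`, with the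
commutator as Lie bracket. -/
abbrev WittAlgebra (p m : ℕ) (k : Type*) [CommRing k] : Type _ :=
  Derivation k (TruncPoly p m k) (TruncPoly p m k)

namespace TruncPoly

section

variable (p m : ℕ) (k : Type*) [Field k]

/-- The generator `x_i`. -/
noncomputable def x (i : Fin m) : TruncPoly p m k := Ideal.Quotient.mk _ (MvPolynomial.X i)

theorem derivation_ext {p m : ℕ} {k : Type*} [Field k] {D E : WittAlgebra p m k} (h : ∀ i, D (x p m k i) = E (x p m k i)) :
    D = E := by
  ext f
  obtain ⟨f, rfl⟩ := Ideal.Quotient.mk_surjective f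
  induction f using MvPolynomial.induction_on with
  | C a =>
    have : (Ideal.Quotient.mk (truncIdeal p m k)) (MvPolynomial.C a) =
      algebraMap k (TruncPoly p m k) a := rfl
    rw [this, Derivation.map_algebraMap, Derivation.map_algebraMap]
  | add f g hf hg => rw [map_add, map_add, map_add, hf, hg]
  | mul_X f i hf =>
    have := h i
    unfold x at this
    rw [map_mul, Derivation.leibniz, Derivation.leibniz, hf, this]

variable [CharP k p]

theorem pderiv_mem (i : Fin m) {f : MvPolynomial (Fin m) k} (hf : f ∈ truncIdeal p m k) :
    MvPolynomial.pderiv i f ∈ truncIdeal p m k := by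
  refine Submodule.span_induction ?_ ?_ ?_ ?_ hf
  · rintro _ ⟨j, rfl⟩
    simp
  · rw [map_zero]; exact zero_mem _
  · intro _ _ _ _ hf hg
    rw [map_add]; exact add_mem hf hg
  · intro a f hf' hf
    rw [smul_eq_mul, Derivation.leibniz, smul_eq_mul, smul_eq_mul]
    exact add_mem (Ideal.mul_mem_left _ _ hf) (Ideal.mul_mem_right _ _ hf')

/-- The partial derivative `∂_i` on `O(m; 1)`. -/
noncomputable def partialD (i : Fin m) : WittAlgebra p m k :=
  Derivation.liftOfRightInverse (f := Ideal.Quotient.mkₐ k (truncIdeal p m k))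
    (f_inv := Function.surjInv (Ideal.Quotient.mkₐ_surjective k (truncIdeal p m k)))
    (Function.rightInverse_surjInv _) (d := MvPolynomial.pderiv i)
    (fun f hf => Ideal.Quotient.eq_zero_iff_mem.2
      (pderiv_mem p m k i (Ideal.Quotient.eq_zero_iff_mem.1 hf)))

variable {p m k}

theorem partialD_mk (i : Fin m) (f : MvPolynomial (Fin m) k) :
    partialD p m k i (Ideal.Quotient.mk _ f) = Ideal.Quotient.mk _ (MvPolynomial.pderiv i f) :=
  Derivation.liftOfRightInverse_apply (f := Ideal.Quotient.mkₐ k (truncIdeal p m k)) _ _ f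

theorem partialD_x (i j : Fin m) :
    partialD p m k i (x p m k j) = if i = j then 1 else 0 := by
  unfold x
  rw [partialD_mk, MvPolynomial.pderiv_X]
  by_cases h : i = j
  · subst h; simp
  · rw [if_neg h, Pi.single_eq_of_ne (Ne.symm h), map_zero]

/-- Every derivation is `∑ f_i ∂_i` with `f_i = D x_i`. -/
theorem derivation_eq (D : WittAlgebra p m k) :
    D = ∑ i, D (x p m k i) • partialD p m k i := by
  refine derivation_ext fun j => ?_
  have : ∀ f, (∑ i, D (x p m k i) • partialD p m k i) f =
      ∑ i, D (x p m k i) * partialD p m k i f := by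
    intro _
    rw [← Derivation.coeFnAddMonoidHom_apply, map_sum, Finset.sum_apply]
    rfl
  rw [this]
  simp [partialD_x]

theorem partialD_comm (i j : Fin m) (f : TruncPoly p m k) :
    partialD p m k i (partialD p m k j f) = partialD p m k j (partialD p m k i f) := by
  have h : ⁅partialD p m k i, partialD p m k j⁆ = 0 := by
    refine derivation_ext fun l => ?_
    rw [Derivation.commutator_apply, partialD_x, partialD_x, Derivation.zero_apply]
    split_ifs <;> simp
  have h' := congrArg (fun D : WittAlgebra p m k => D f) h
  simpa [Derivation.commutator_apply, sub_eq_zero] using h'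

/-- The divergence `∑ ∂_i (f_i)` of `∑ f_i ∂_i`. -/
noncomputable def divergence (D : WittAlgebra p m k) : TruncPoly p m k :=
  ∑ i, partialD p m k i (D (x p m k i))

theorem derivation_apply (D : WittAlgebra p m k) (f : TruncPoly p m k) :
    D f = ∑ i, D (x p m k i) * partialD p m k i f := by
  conv_lhs => rw [derivation_eq D]
  rw [← Derivation.coeFnAddMonoidHom_apply, map_sum, Finset.sum_apply]
  rfl

theorem divergence_add (D E : WittAlgebra p m k) :
    divergence (D + E) = divergence D + divergence E := by
  simp [divergence, Finset.sum_add_distrib]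

theorem divergence_smul (c : k) (D : WittAlgebra p m k) :
    divergence (c • D) = c • divergence D := by
  simp [divergence, Finset.smul_sum]

theorem divergence_lie (D E : WittAlgebra p m k) :
    divergence ⁅D, E⁆ = D (divergence E) - E (divergence D) := by
  have key : ∀ D E : WittAlgebra p m k, ∑ i, partialD p m k i (D (E (x p m k i))) =
      D (divergence E) + ∑ i, ∑ j, partialD p m k i (D (x p m k j)) *
        partialD p m k j (E (x p m k i)) := by
    intro D E
    unfold divergence
    rw [map_sum, ← Finset.sum_add_distrib]
    refine Finset.sum_congr rfl fun i _ => ?_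
    rw [derivation_apply D (E (x p m k i)), derivation_apply D (partialD p m k i (E _)), map_sum,
      ← Finset.sum_add_distrib]
    refine Finset.sum_congr rfl fun j _ => ?_
    rw [Derivation.leibniz, smul_eq_mul, smul_eq_mul, partialD_comm i j]
    ring
  have h : divergence ⁅D, E⁆ = ∑ i, partialD p m k i (D (E (x p m k i))) -
      ∑ i, partialD p m k i (E (D (x p m k i))) := by
    simp [divergence, Derivation.commutator_apply, Finset.sum_sub_distrib]
  rw [h, key D E, key E D, Finset.sum_comm (f := fun i j => partialD p m k i (E (x p m k j)) * _)]
  have : ∑ j, ∑ i, partialD p m k i (E (x p m k j)) * partialD p m k j (D (x p m k i)) =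
      ∑ i, ∑ j, partialD p m k i (D (x p m k j)) * partialD p m k j (E (x p m k i)) :=
    Finset.sum_congr rfl fun i _ => Finset.sum_congr rfl fun j _ => mul_comm _ _
  rw [this]
  ring

end

end TruncPoly

section Hamiltonian

variable (p : ℕ) (k : Type*) [Field k] [CharP k p]

open TruncPoly

/-- The Hamiltonian algebra `H(2; 1)`: all `D = f₁ ∂₁ + f₂ ∂₂` in `W(2; 1)` that annihilate the
form `dx₁ ∧ dx₂`, that is, with `∂₁(f₁) + ∂₂(f₂) = 0`. -/
noncomputable def hamiltonian : LieSubalgebra k (WittAlgebra p 2 k) where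
  carrier := {D | partialD p 2 k 0 (D (x p 2 k 0)) + partialD p 2 k 1 (D (x p 2 k 1)) = 0}
  add_mem' {D E} hD hE := by
    have h := divergence_add D E
    simp only [divergence, Fin.sum_univ_two] at h
    simp only [Set.mem_ofPred_eq] at *
    rw [h, hD, hE, add_zero]
  zero_mem' := by simp
  smul_mem' c D hD := by
    have h := divergence_smul c D
    simp only [divergence, Fin.sum_univ_two] at h
    simp only [Set.mem_ofPred_eq] at *
    rw [h, hD, smul_zero]
  lie_mem' {D E} hD hE := by
    have h := divergence_lie D E
    simp only [divergence, Fin.sum_univ_two] at h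
    change partialD p 2 k 0 (D (x p 2 k 0)) + partialD p 2 k 1 (D (x p 2 k 1)) = 0 at hD
    change partialD p 2 k 0 (E (x p 2 k 0)) + partialD p 2 k 1 (E (x p 2 k 1)) = 0 at hE
    change partialD p 2 k 0 (⁅D, E⁆ (x p 2 k 0)) + partialD p 2 k 1 (⁅D, E⁆ (x p 2 k 1)) = 0
    rw [h, hD, hE, map_zero, map_zero, sub_zero]

/-- The degree derivation `x₁ ∂₁ + x₂ ∂₂`. -/
noncomputable def degreeD : WittAlgebra p 2 k :=
  x p 2 k 0 • partialD p 2 k 0 + x p 2 k 1 • partialD p 2 k 1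

theorem mem_hamiltonian {D : WittAlgebra p 2 k} : D ∈ hamiltonian p k ↔ divergence D = 0 := by
  rw [divergence, Fin.sum_univ_two]; rfl

theorem divergence_degreeD : divergence (degreeD p k) = 2 := by
  simp [divergence, degreeD, partialD_x, Fin.sum_univ_two, one_add_one_eq_two]

/-- The Lie algebra `CH(2; 1) = H(2; 1) + k (x₁ ∂₁ + x₂ ∂₂)`. -/
noncomputable def conformalHamiltonian : LieSubalgebra k (WittAlgebra p 2 k) where
  toSubmodule := (hamiltonian p k).toSubmodule ⊔ k ∙ degreeD p k
  lie_mem' {D E} hD hE := by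
    have aux : ∀ {D : WittAlgebra p 2 k}, D ∈ (hamiltonian p k).toSubmodule ⊔ k ∙ degreeD p k →
        ∃ c : k, divergence D = c • 2 := by
      intro D hD
      obtain ⟨A, hA, B, hB, rfl⟩ := Submodule.mem_sup.1 hD
      obtain ⟨c, rfl⟩ := Submodule.mem_span_singleton.1 hB
      refine ⟨c, ?_⟩
      rw [divergence_add, divergence_smul, divergence_degreeD, (mem_hamiltonian p k).1 hA,
        zero_add]
    obtain ⟨c, hc⟩ := aux hD
    obtain ⟨d, hd⟩ := aux hE
    refine Submodule.mem_sup_left ((mem_hamiltonian p k).2 ?_)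
    rw [divergence_lie, hc, hd]
    have h2 : ∀ F : WittAlgebra p 2 k, F (2 : TruncPoly p 2 k) = 0 := fun F => by
      have := F.map_natCast 2
      simpa using this
    rw [D.map_smul, E.map_smul, h2, h2, smul_zero, smul_zero, sub_zero]

end Hamiltonian

/-!
The proof reduces the theorem to linear algebra over the prime field in one adapted basis, and then
to properties of the Witt algebra `W(2; 1)`.

*Adapted basis.*  The root elements of the Chevalley group act by automorphisms
(`chevalleyGroup_map_lie`): as `(ad e_α)³ = 0` on the integral form, the identities behind this,
which need a division by `3`, hold over the integers and persist under base change.  Hence every element of the orbit is the first vector `b₀` of a basis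
`b₀, …, b₅₁` whose structure constants are those of one explicit basis (`exists_isAdapted`,
`IsAdapted`), and everything else is proved from these structure constants modulo `3`.

*The twisted action.*  The span `A` of `b₀, …, b₇` is abelian.  Identify it with the span of the
monomials other than `x₁² x₂²` in the truncated polynomial ring, with `b₀` as `1` (`toPoly`).  The
span of `b₀, …, b₂₅` is the normaliser of `A`, and maps onto `W(2; 1)` with kernel `A` (`toWitt`).
Its action on `A` is the twisted action `D · f = D(f) + div(D) f` (`toPoly_lie`).  As this action is
faithful, `toWitt` is a homomorphism on the normaliser of `A` (`toWitt_lie`).  As `D · 1 = div(D)`,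
the centraliser and the normaliser of `b₀` are the preimages of `H(2; 1)` and `CH(2; 1)`; that they
lie in the normaliser of `A` is a rank computation for `ad b₀` (`mem_of_lie_mem`).

*Radicals.*  A nonzero subspace of `W(2; 1)` that is stable under `H(2; 1)` contains `∂₁` and `∂₂`,
and is not abelian (`exists_lie_ne_zero_of_stable`).  Hence a homomorphism to `W(2; 1)` whose image
contains `H(2; 1)` kills all solvable ideals (`le_ker_of_isSolvable`).  So in the three cases the
radical is `A`, and the quotients are `H(2; 1)`, `CH(2; 1)` and `W(2; 1)` (`radical_of_preimage`).

*Maximality.*  The quotient of the Lie algebra by the normaliser of `A` is the dual of the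
normaliser, and the elements acting like `∂₁`, `∂₂`, `x₂ ∂₁`, together with `b₀`, act on it by
nilpotent operators whose common kernel is spanned by `b₂₆`.  Hence a larger subalgebra contains
`b₂₆` (`basis_mem_of_gt`), and repeated brackets give all basis vectors (`isCoatom`).  The normaliser
of `A` has dimension `26`, while parabolic subalgebras have dimension at least `28`.
-/

/-! ### The adapted basis and its structure constants modulo three

The statements about structure constants are boolean, and use `Nat.blt`, `Int.mul` and the like
instead of the usual notation, so that the kernel evaluates them quickly. -/

namespace F4

/-- The bracket of two integral combinations of Chevalley basis vectors, each given as a list of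
pairs (code of a basis vector, coefficient). -/
def lieList (u v : List (ℕ × ℤ)) : List (ℕ × ℤ) :=
  u.flatMap fun p => v.flatMap fun q => (sparse p.1 q.1).map fun s =>
    (s.1, Int.mul (Int.mul p.2 q.2) s.2)

/-- The value on the combination `v` of the linear form with coefficients `u`. -/
def dot (u v : List (ℕ × ℤ)) : ℤ :=
  u.foldr (fun p r => Int.add (Int.mul p.2 (coef v p.1)) r) 0

/-- The basis `b₀, …, b₅₁` adapted to `b₀ = e_{1000} + e_{0010} + e_{0001}`, in terms of the
Chevalley basis.

* `b_{3 i + j}` for `3 i + j < 8` spans the radical `A` of the centraliser of `b₀`, and corresponds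
  to the monomial `x₁ⁱ x₂ʲ` of the truncated polynomial ring;
* `b_{8 + 2 (3 i + j) + d}` for `i, j < 3` and `d < 2` lies in the normaliser of `A`, and acts on
  `A` like `x₁ⁱ x₂ʲ ∂_{d + 1}`;
* `b_{51 - t}` for `t < 26` pairs to `1` with `b_t`, and to `0` with the other `b_s` for `s < 26`,
  under an invariant bilinear form, for which the normaliser of `A` is maximal isotropic. -/
def adaptedVec (i : ℕ) : List (ℕ × ℤ) :=
  List.getD [
    [(0, 1), (2, 1), (3, 1)], [(28, -1), (29, -1)], [(37, -1)], [(14, -1), (15, -1)], [(6, 1)],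
    [(25, 1)], [(21, 1)], [(17, 1)], [(34, 1), (35, -1), (36, 1)], [(7, -1), (8, -1), (9, 1)],
    [(42, 1), (43, -1)], [(48, -1), (50, -1)], [(46, 1)], [(31, 1), (32, 1)],
    [(48, -1), (51, -1)], [(18, 1), (19, -1)], [(31, -1), (33, -1)], [(11, 1), (12, 1)],
    [(40, -1)], [(3, 1)], [(10, -1), (12, -1)], [(23, -1)], [(2, -1)], [(20, -1)], [(29, -1)],
    [(15, -1)], [(38, -1), (39, -1)], [(4, 1), (5, 1)], [(44, 1)], [(24, 1), (26, 1)], [(47, -1)],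
    [(34, -1)], [(24, -1), (27, -1)], [(16, 1)], [(35, -1)], [(9, 1)], [(43, -1)], [(49, 1)],
    [(8, 1)], [(22, 1)], [(48, 1), (49, -1)], [(19, -1)], [(31, 1)], [(11, 1)], [(41, 1)],
    [(45, 1)], [(1, 1)], [(30, -1)], [(38, 1)], [(13, -1)], [(4, -1)], [(24, 1)]] i []

/-- The coordinate forms of the adapted basis (modulo `3`), in terms of the dual of the Chevalley
basis. -/
def adaptedForm (i : ℕ) : List (ℕ × ℤ) :=
  List.getD [
    [(0, 1)], [(28, -1)], [(37, -1)], [(14, -1)], [(6, 1)], [(25, 1)], [(21, 1)], [(17, 1)],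
    [(36, 1)], [(7, -1)], [(42, 1)], [(50, -1)], [(46, 1)], [(32, 1)], [(51, -1)], [(18, 1)],
    [(33, -1)], [(10, -1), (12, 1)], [(40, -1)], [(0, -1), (3, 1)], [(10, -1)], [(23, -1)],
    [(0, 1), (2, -1)], [(20, -1)], [(28, 1), (29, -1)], [(14, 1), (15, -1)], [(39, -1)], [(5, 1)],
    [(44, 1)], [(26, 1)], [(47, -1)], [(34, -1), (36, 1)], [(27, -1)], [(16, 1)],
    [(35, -1), (36, -1)], [(7, 1), (9, 1)], [(42, -1), (43, -1)],
    [(48, 1), (49, 1), (50, -1), (51, -1)], [(7, -1), (8, 1)], [(22, 1)],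
    [(48, 1), (50, -1), (51, -1)], [(18, -1), (19, -1)], [(31, 1), (32, -1), (33, -1)],
    [(10, 1), (11, 1), (12, -1)], [(41, 1)], [(45, 1)], [(1, 1)], [(30, -1)], [(38, 1), (39, -1)],
    [(13, -1)], [(4, -1), (5, 1)], [(24, 1), (26, -1), (27, -1)]] i []

/-- An integer which modulo `3` is the coefficient of `b_l` in `⁅b_i, b_j⁆`. -/
def structConst (i j l : ℕ) : ℤ := dot (adaptedForm l) (lieList (adaptedVec i) (adaptedVec j))

/-- Congruence modulo `3`, as a boolean that the kernel evaluates quickly. -/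
def modEq (a b : ℤ) : Bool := Nat.beq (Nat.mod (Int.natAbs (Int.sub a b)) 3) 0

/-- The coefficient of `b_l` in `⁅b_i, b_a⁆` for `8 ≤ i < 26` and `a < 8`.  When `b_i` stands for
`D = x^m ∂_d` and `b_a` for `x^a`, the bracket stands for
`D (x^a) + div(D) x^a = (m_d + a_d) x^{m + a - ε_d}`.  The truncated subtraction is harmless, as
`m_d + a_d = 0` when it matters. -/
def twistedCoeff (i a l : ℕ) : ℤ :=
  let m := i / 2 - 4
  let d := i % 2
  let p := m / 3 + a / 3 - (1 - d)
  let q := m % 3 + a % 3 - d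
  if p < 3 ∧ q < 3 ∧ l = 3 * p + q then
    ((if d = 0 then m / 3 + a / 3 else m % 3 + a % 3 : ℕ) : ℤ) else 0

/-- For `26 ≤ j`, the index of a coordinate that is nonzero on `⁅b₀, b_j⁆` and zero on `⁅b₀, b_i⁆`
for all `i < j`. -/
def pivot (j : ℕ) : ℕ :=
  if j < 44 then j - 18 else List.getD [26, 28, 27, 29, 31, 33, 35, 37] (j - 44) 0

/-- For `26 < t`, the index of an element which, modulo the normaliser of `A`, moves a combination
of `b₂₆, …, b_t` with leading term `b_t` to a nonzero combination of earlier basis vectors.  The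
elements used act on `A` like `∂₁`, `∂₂` and `x₂ ∂₁`, or lie in `A` (for `b₀`). -/
def lowerOp (t : ℕ) : ℕ := if t < 28 then 10 else if t < 32 then 9 else if t < 44 then 8 else 0

/-- The index of a basis vector that occurs in `⁅b_{lowerOp t}, b_t⁆`, but not in the brackets with
earlier basis vectors. -/
def lowerTo (t : ℕ) : ℕ :=
  if t < 28 then 26 else if t < 32 then t - 2 else if t < 44 then t - 6 else pivot t

/-- Triples `(t, i, j)` where `⁅b_i, b_j⁆` is a nonzero multiple of `b_t` up to vectors that are
already known, starting from `b₀, …, b₂₆`. -/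
def raising : List (ℕ × ℕ × ℕ) :=
  [
    (28, 13, 26), (27, 15, 26), (30, 18, 26), (32, 20, 26), (33, 21, 26), (34, 22, 26),
    (36, 24, 26), (29, 17, 26), (31, 19, 26), (46, 33, 26), (35, 19, 27), (38, 22, 27),
    (39, 23, 27), (41, 25, 27), (44, 28, 27), (45, 30, 27), (47, 34, 27), (48, 36, 27),
    (37, 23, 28), (42, 25, 28), (50, 39, 28), (51, 41, 28), (40, 21, 30), (43, 25, 32),
    (49, 33, 32)]

/-- The verification of a list of triples as in `raising`, starting from the indices `known`. -/
def raiseOK (known : List ℕ) : List (ℕ × ℕ × ℕ) → Bool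
  | [] => true
  | s :: r => (Nat.blt s.1 52 && known.contains s.2.1 &&
      known.contains s.2.2 && !modEq (structConst s.2.1 s.2.2 s.1) 0 &&
      (List.range 52).all fun l => Nat.beq l s.1 || known.contains l ||
        modEq (structConst s.2.1 s.2.2 l) 0) && raiseOK (s.1 :: known) r

section Tables

set_option maxRecDepth 100000

/-- The forms `adaptedForm` are dual to the vectors `adaptedVec` modulo `3`. -/
theorem adapted_dual : ((List.range 52).all fun i => (List.range 52).all fun j =>
    modEq (dot (adaptedForm i) (adaptedVec j)) (bif Nat.beq i j then 1 else 0)) = true := by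
  decide +kernel

theorem adaptedVec_lt : ((List.range 52).all fun i => (adaptedVec i).all fun t =>
    Nat.blt t.1 52) = true := by
  decide +kernel

theorem adaptedForm_lt : ((List.range 52).all fun i => (adaptedForm i).all fun t =>
    Nat.blt t.1 52) = true := by
  decide +kernel

/-- The brackets of `b₀, …, b₂₅` with `b₀, …, b₇`. -/
theorem structConst_action : ((List.range 26).all fun i => (List.range 8).all fun a =>
    (List.range 52).all fun l =>
      modEq (structConst i a l) (bif Nat.blt i 8 then 0 else twistedCoeff i a l)) = true := by
  decide +kernel

/-- `A` is preserved: the only monomial of degree four does not occur in the twisted action. -/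
theorem twistedCoeff_of_le : ((List.range 26).all fun i => (List.range 8).all fun a =>
    (List.range 52).all fun l =>
      Nat.blt i 8 || Nat.blt l 8 || modEq (twistedCoeff i a l) 0) = true := by
  decide +kernel

/-- Triangularity of `ad b₀`. -/
theorem structConst_pivot : ((List.range 52).all fun t => Nat.blt t 26 ||
    (Nat.ble 8 (pivot t) && !modEq (structConst 0 t (pivot t)) 0 &&
      (List.range t).all fun j => modEq (structConst 0 j (pivot t)) 0)) = true := by
  decide +kernel

/-- Modulo `b₀, …, b₂₅`, the operators used for lowering are strictly triangular. -/
theorem structConst_lower : ([0, 8, 9, 10].all fun u => (List.range 52).all fun l =>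
    Nat.blt l 26 || (List.range (l + 1)).all fun j => modEq (structConst u j l) 0) = true := by
  decide +kernel

/-- The operator `lowerOp t` does not kill vectors with leading term `b_t`. -/
theorem structConst_lowerTo : ((List.range 52).all fun t => Nat.ble t 26 ||
    (Nat.ble 26 (lowerTo t) && !modEq (structConst (lowerOp t) t (lowerTo t)) 0 &&
      (List.range t).all fun j => modEq (structConst (lowerOp t) j (lowerTo t)) 0)) = true := by
  decide +kernel

theorem pivot_lt : ∀ t : Fin 52, pivot t < 52 := by decide +kernel

theorem lowerTo_lt : ∀ t : Fin 52, lowerTo t < 52 := by decide +kernel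

theorem raising_ok : raiseOK (List.range 27) raising = true := by
  decide +kernel

/-- Every `b_l` with `27 ≤ l` is the first entry of a triple in `raising`. -/
theorem raising_all : ((List.range 52).all fun l => Nat.blt l 27 ||
    raising.any fun s => Nat.beq s.1 l) = true := by
  decide +kernel

/-- `(ad e_α)³ = 0` on the integral form. -/
theorem ad_cube_ok : ((List.range 48).all fun i => (List.range 52).all fun j =>
    allZero (lieList [(i, 1)] (lieList [(i, 1)] (lieList [(i, 1)] [(j, 1)])))) = true := by
  decide +kernel

end Tables

theorem _root_.two_ne_zero_of_charP_three {k : Type*} [Field k] [CharP k 3] : (2 : k) ≠ 0 := by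
  intro h
  have h3 : (3 : k) = 0 := by simpa using CharP.cast_eq_zero k 3
  have h1 : (1 : k) = 0 := by linear_combination h3 - h
  exact one_ne_zero h1

theorem modEq_iff (k : Type*) [Field k] [CharP k 3] (a b : ℤ) :
    modEq a b = true ↔ (a : k) = b := by
  rw [CharP.intCast_eq_intCast k 3, Int.modEq_comm, Int.modEq_iff_dvd]
  change Nat.beq ((a - b).natAbs % 3) 0 = true ↔ _
  rw [Nat.beq_eq, ← Nat.dvd_iff_mod_eq_zero, ← Int.natCast_dvd]

theorem coef_append (u v : List (ℕ × ℤ)) (l : ℕ) : coef (u ++ v) l = coef u l + coef v l := by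
  simp [coef]

theorem coef_flatMap {ι : Type*} (u : List ι) (f : ι → List (ℕ × ℤ)) (l : ℕ) :
    coef (u.flatMap f) l = (u.map fun p => coef (f p) l).sum := by
  induction u with
  | nil => simp [coef]
  | cons p u ih => rw [List.flatMap_cons, coef_append, ih, List.map_cons, List.sum_cons]

theorem coef_map_mul (c : ℤ) (v : List (ℕ × ℤ)) (l : ℕ) :
    coef (v.map fun t => (t.1, Int.mul c t.2)) l = c * coef v l := by
  induction v with
  | nil => simp [coef]
  | cons t v ih =>
    simp only [coef, List.map_cons, List.sum_cons] at ih ⊢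
    rw [ih, mul_add]
    split_ifs
    · rfl
    · simp

theorem coef_lieList (u v : List (ℕ × ℤ)) (l : ℕ) : coef (lieList u v) l =
    (u.map fun p => p.2 * (v.map fun q => q.2 * coef (sparse p.1 q.1) l).sum).sum := by
  unfold lieList
  rw [coef_flatMap]
  congr 1
  refine List.map_congr_left fun p _ => ?_
  rw [coef_flatMap, ← List.sum_map_mul_left]
  congr 1
  refine List.map_congr_left fun q _ => ?_
  rw [coef_map_mul, show Int.mul p.2 q.2 = p.2 * q.2 from rfl, mul_assoc]

theorem dot_eq_sum (u v : List (ℕ × ℤ)) : dot u v = (u.map fun p => p.2 * coef v p.1).sum := by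
  induction u with
  | nil => rfl
  | cons p u ih => rw [List.map_cons, List.sum_cons, ← ih]; rfl

theorem lieList_lt {u v : List (ℕ × ℤ)} (hu : ∀ t ∈ u, t.1 < 52) (hv : ∀ t ∈ v, t.1 < 52) :
    ∀ t ∈ lieList u v, t.1 < 52 := by
  intro t ht
  obtain ⟨p, hp, ht⟩ := List.mem_flatMap.1 ht
  obtain ⟨q, hq, ht⟩ := List.mem_flatMap.1 ht
  obtain ⟨s, hs, rfl⟩ := List.mem_map.1 ht
  have h := List.all_eq_true.1 (List.all_eq_true.1 sparse_anti _
    (List.mem_range.2 (hu p hp))) _ (List.mem_range.2 (hv q hq))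
  rw [Bool.and_eq_true] at h
  simpa [Nat.blt_eq] using List.all_eq_true.1 h.2 s hs

end F4

/-! ### Integral combinations of the Chevalley basis, and base change -/

namespace LieF4

open F4

section OfList

variable {R : Type*} [CommRing R]

/-- The element of the Lie algebra with a given list of integral coefficients. -/
def ofList (R : Type*) [CommRing R] (v : List (ℕ × ℤ)) : LieF4 R := fun m => (coef v (code m) : R)

theorem ofList_apply (v : List (ℕ × ℤ)) (m : Idx) : ofList R v m = (coef v (code m) : R) := rfl

theorem lie_ofList {u v : List (ℕ × ℤ)} (hu : ∀ t ∈ u, t.1 < 52) (hv : ∀ t ∈ v, t.1 < 52) :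
    ⁅ofList R u, ofList R v⁆ = ofList R (lieList u v) := by
  ext l
  rw [lie_apply, ofList_apply, coef_lieList,
    ← sum_coef (fun n => (v.map fun q => q.2 * coef (sparse n q.1) (code l)).sum) u hu,
    Int.cast_sum]
  refine Finset.sum_congr rfl fun i _ => ?_
  rw [← sum_coef (fun n => coef (sparse (code i) n) (code l)) v hv, Int.cast_mul, Int.cast_sum,
    Finset.mul_sum]
  refine Finset.sum_congr rfl fun j _ => ?_
  rw [ofList_apply, ofList_apply, sc_eq, Int.cast_mul, mul_assoc]

theorem coef_singleton (n : ℕ) (c : ℤ) (l : ℕ) : coef [(n, c)] l = if n = l then c else 0 := by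
  simp [coef]

theorem rootVec_eq_ofList (α : Root) : rootVec R α = ofList R [(code (.inl α), 1)] := by
  ext l
  rw [ofList_apply, coef_singleton]
  by_cases h : l = .inl α
  · subst h; simp [rootVec]
  · rw [if_neg fun h' => h (code_inj h').symm]
    simp [rootVec, h]

/-- The Chevalley basis vector of a given index. -/
def chev (R : Type*) [CommRing R] (i : Idx) : LieF4 R := ofList R [(code i, 1)]

theorem chev_apply (i l : Idx) : chev R i l = if i = l then 1 else 0 := by
  rw [chev, ofList_apply, coef_singleton]
  by_cases h : i = l
  · simp [h]
  · rw [if_neg fun h' => h (code_inj h'), if_neg h, Int.cast_zero]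

theorem sum_chev (c : Idx → R) : ∑ i, c i • chev R i = (c : LieF4 R) := by
  ext l
  have h : ∀ s : Finset Idx, (∑ i ∈ s, c i • chev R i) l = ∑ i ∈ s, c i * chev R i l := by
    intro s
    induction s using Finset.induction_on with
    | empty => rfl
    | insert a s ha ih => rw [Finset.sum_insert ha, Finset.sum_insert ha, add_apply, ih]; rfl
  rw [h]
  rw [Finset.sum_eq_single l, chev_apply, if_pos rfl, mul_one]
  · intro i _ hi
    rw [chev_apply, if_neg hi, mul_zero]
  · exact fun hl => absurd (Finset.mem_univ l) hl

/-- A bilinear expression vanishes if it vanishes on the Chevalley basis. -/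
theorem bilin_eq_zero (f : LieF4 R →ₗ[R] LieF4 R →ₗ[R] LieF4 R)
    (h : ∀ i j, f (chev R i) (chev R j) = 0) (x y : LieF4 R) : f x y = 0 := by
  obtain ⟨c, rfl⟩ : ∃ c : Idx → R, ∑ i, c i • chev R i = x := ⟨x, sum_chev x⟩
  obtain ⟨d, rfl⟩ : ∃ d : Idx → R, ∑ i, d i • chev R i = y := ⟨y, sum_chev y⟩
  rw [map_sum]
  refine Finset.sum_eq_zero fun j _ => ?_
  rw [map_smul, map_sum, LinearMap.sum_apply, Finset.sum_eq_zero fun i _ => by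
    rw [map_smul, LinearMap.smul_apply, h, smul_zero], smul_zero]

/-- Extension of scalars from the integers. -/
def ofInt (R : Type*) [CommRing R] (x : LieF4 ℤ) : LieF4 R := fun l => (x l : R)

theorem ofInt_lie (x y : LieF4 ℤ) : ofInt R ⁅x, y⁆ = ⁅ofInt R x, ofInt R y⁆ := by
  ext l
  rw [lie_apply]
  change ((⁅x, y⁆ l : ℤ) : R) = _
  rw [lie_apply]
  push_cast
  rfl

theorem ofInt_add (x y : LieF4 ℤ) : ofInt R (x + y) = ofInt R x + ofInt R y := by
  ext l
  change (((x + y) l : ℤ) : R) = (x l : R) + (y l : R)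
  rw [add_apply]
  push_cast
  rfl

theorem ofInt_chev (i : Idx) : ofInt R (chev ℤ i) = chev R i := by
  ext l
  change ((chev ℤ i l : ℤ) : R) = _
  rw [chev_apply, chev_apply]
  split_ifs <;> simp

theorem ofInt_zero : ofInt R 0 = 0 := by
  ext l
  change (((0 : LieF4 ℤ) l : ℤ) : R) = _
  rw [zero_apply, zero_apply, Int.cast_zero]

end OfList

/-! ### The Chevalley group acts by automorphisms -/

theorem rootVec_eq_chev {R : Type*} [CommRing R] (α : Root) : rootVec R α = chev R (.inl α) :=
  rootVec_eq_ofList α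

theorem ad_cube_int (α : Root) (x : LieF4 ℤ) :
    ⁅rootVec ℤ α, ⁅rootVec ℤ α, ⁅rootVec ℤ α, x⁆⁆⁆ = 0 := by
  have key : ∀ j, ⁅rootVec ℤ α, ⁅rootVec ℤ α, ⁅rootVec ℤ α, chev ℤ j⁆⁆⁆ = 0 := by
    intro j
    have h := List.all_eq_true.1 (List.all_eq_true.1 ad_cube_ok _
      (List.mem_range.2 (code_root_lt α))) _ (List.mem_range.2 (code_lt j))
    have h1 : ∀ t ∈ [(code (.inl α), (1 : ℤ))], t.1 < 52 := by simpa using code_lt _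
    have h2 : ∀ t ∈ [(code j, (1 : ℤ))], t.1 < 52 := by simpa using code_lt _
    rw [rootVec_eq_ofList, chev, lie_ofList h1 h2, lie_ofList h1 (lieList_lt h1 h2),
      lie_ofList h1 (lieList_lt h1 (lieList_lt h1 h2))]
    ext l
    rw [ofList_apply, coef_of_allZero h, Int.cast_zero, zero_apply]
  obtain ⟨c, rfl⟩ : ∃ c : Idx → ℤ, ∑ i, c i • chev ℤ i = x := ⟨x, sum_chev x⟩
  let D : LieF4 ℤ →ₗ[ℤ] LieF4 ℤ := LieAlgebra.ad ℤ (LieF4 ℤ) (rootVec ℤ α)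
  change D (D (D (∑ i, c i • chev ℤ i))) = 0
  rw [map_sum, map_sum, map_sum]
  refine Finset.sum_eq_zero fun i _ => ?_
  rw [map_smul, map_smul, map_smul]
  exact (congrArg (c i • ·) (key i)).trans (smul_zero _)

theorem int_torsion_free {c : ℤ} (hc : c ≠ 0) {x : LieF4 ℤ} (h : c • x = 0) : x = 0 := by
  ext l
  have := congrFun h l
  change c * x l = 0 at this
  exact (mul_eq_zero.1 this).resolve_left hc

/-- The cubic term of the expansion of `⁅exp(D) x, exp(D) y⁆`, for `D = ad e_α`, is zero.  Over the
integers, `3` times this term is `D³ ⁅x, y⁆ = 0`; the general case follows by base change. -/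
theorem ad_sq_cross {k : Type*} [CommRing k] (α : Root) (x y : LieF4 k) :
    ⁅⁅rootVec k α, x⁆, ⁅rootVec k α, ⁅rootVec k α, y⁆⁆⁆ +
      ⁅⁅rootVec k α, ⁅rootVec k α, x⁆⁆, ⁅rootVec k α, y⁆⁆ = 0 := by
  have hZ : ∀ x y : LieF4 ℤ, ⁅⁅rootVec ℤ α, x⁆, ⁅rootVec ℤ α, ⁅rootVec ℤ α, y⁆⁆⁆ +
      ⁅⁅rootVec ℤ α, ⁅rootVec ℤ α, x⁆⁆, ⁅rootVec ℤ α, y⁆⁆ = 0 := by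
    intro x y
    refine int_torsion_free (c := 3) (by norm_num) ?_
    have h := ad_cube_int α ⁅x, y⁆
    simp only [leibniz_lie (rootVec ℤ α) x y, lie_add, leibniz_lie (rootVec ℤ α) ⁅_, x⁆ _,
      leibniz_lie (rootVec ℤ α) x ⁅_, y⁆, leibniz_lie (rootVec ℤ α) ⁅_, ⁅_, x⁆⁆ _,
      leibniz_lie (rootVec ℤ α) x ⁅_, ⁅_, y⁆⁆, ad_cube_int, zero_lie, lie_zero] at h
    rw [← h]
    abel
  let D : LieF4 k →ₗ[k] LieF4 k := LieAlgebra.ad k (LieF4 k) (rootVec k α)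
  let B : LieF4 k →ₗ[k] LieF4 k →ₗ[k] LieF4 k := LieAlgebra.ad k (LieF4 k)
  refine bilin_eq_zero (B.compl₁₂ D (D ∘ₗ D) + B.compl₁₂ (D ∘ₗ D) D) ?_ x y
  intro i j
  change ⁅⁅rootVec k α, chev k i⁆, ⁅rootVec k α, ⁅rootVec k α, chev k j⁆⁆⁆ +
      ⁅⁅rootVec k α, ⁅rootVec k α, chev k i⁆⁆, ⁅rootVec k α, chev k j⁆⁆ = 0
  have h := congrArg (ofInt k) (hZ (chev ℤ i) (chev ℤ j))
  simpa only [rootVec_eq_chev, ofInt_add, ofInt_lie, ofInt_chev, ofInt_zero] using h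

/-- The quartic term of the expansion of `⁅exp(D) x, exp(D) y⁆`, for `D = ad e_α`, is zero. -/
theorem ad_sq_sq {k : Type*} [CommRing k] (α : Root) (x y : LieF4 k) :
    ⁅⁅rootVec k α, ⁅rootVec k α, x⁆⁆, ⁅rootVec k α, ⁅rootVec k α, y⁆⁆⁆ = 0 := by
  have hZ : ∀ x y : LieF4 ℤ,
      ⁅⁅rootVec ℤ α, ⁅rootVec ℤ α, x⁆⁆, ⁅rootVec ℤ α, ⁅rootVec ℤ α, y⁆⁆⁆ = 0 := by
    intro x y
    have h := ad_sq_cross α ⁅rootVec ℤ α, x⁆ y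
    rwa [ad_cube_int, zero_lie, add_zero] at h
  let D : LieF4 k →ₗ[k] LieF4 k := LieAlgebra.ad k (LieF4 k) (rootVec k α)
  let B : LieF4 k →ₗ[k] LieF4 k →ₗ[k] LieF4 k := LieAlgebra.ad k (LieF4 k)
  refine bilin_eq_zero (B.compl₁₂ (D ∘ₗ D) (D ∘ₗ D)) ?_ x y
  intro i j
  change ⁅⁅rootVec k α, ⁅rootVec k α, chev k i⁆⁆, ⁅rootVec k α, ⁅rootVec k α, chev k j⁆⁆⁆ = 0
  have h := congrArg (ofInt k) (hZ (chev ℤ i) (chev ℤ j))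
  simpa only [rootVec_eq_chev, ofInt_lie, ofInt_chev, ofInt_zero] using h

theorem chevalleyGroup_map_lie {k : Type*} [Field k] [CharP k 3] {g : LieF4 k ≃ₗ[k] LieF4 k}
    (hg : g ∈ chevalleyGroup k) (x y : LieF4 k) : g ⁅x, y⁆ = ⁅g x, g y⁆ := by
  have h2 : (2 : k) ≠ 0 := two_ne_zero_of_charP_three
  induction hg using Subgroup.closure_induction generalizing x y with
  | mem φ h =>
    obtain ⟨α, t, h⟩ := h
    rw [h, h, h]
    have h3 := ad_sq_cross α x y
    have h4 := ad_sq_sq α x y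
    set e := rootVec k α
    have hxy : ⁅e, ⁅e, ⁅x, y⁆⁆⁆ =
        ⁅⁅e, ⁅e, x⁆⁆, y⁆ + (2 : k) • ⁅⁅e, x⁆, ⁅e, y⁆⁆ + ⁅x, ⁅e, ⁅e, y⁆⁆⁆ := by
      rw [leibniz_lie e x y, lie_add, leibniz_lie e ⁅e, x⁆ y, leibniz_lie e x ⁅e, y⁆, two_smul]
      abel
    have h3' : ⁅⁅e, x⁆, ⁅e, ⁅e, y⁆⁆⁆ = -⁅⁅e, ⁅e, x⁆⁆, ⁅e, y⁆⁆ := eq_neg_of_add_eq_zero_left h3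
    rw [hxy, leibniz_lie e x y]
    simp only [add_lie, lie_add, smul_lie, lie_smul, h4, h3']
    match_scalars <;> (field_simp; try ring)
  | one => rfl
  | mul a b _ _ iha ihb =>
    change a (b ⁅x, y⁆) = ⁅a (b x), a (b y)⁆
    rw [ihb, iha]
  | inv a _ iha =>
    change a.symm ⁅x, y⁆ = ⁅a.symm x, a.symm y⁆
    rw [LinearEquiv.symm_apply_eq, iha, LinearEquiv.apply_symm_apply, LinearEquiv.apply_symm_apply]

end LieF4

/-! ### Bases with the structure constants of the adapted basis -/

/-- A basis whose brackets have the structure constants of the adapted basis. -/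
structure IsAdapted {k L : Type*} [Field k] [LieRing L] [LieAlgebra k L]
    (b : Module.Basis (Fin 52) k L) : Prop where
  repr_lie : ∀ i j l : Fin 52, b.repr ⁅b i, b j⁆ l = (F4.structConst i j l : k)

namespace LieF4

open F4

section Basis

variable (k : Type*) [Field k]

/-- The coordinate forms of the adapted basis. -/
def adaptedCoord (l : ℕ) : LieF4 k →ₗ[k] k where
  toFun x := ∑ m, (coef (adaptedForm l) (code m) : k) * x m
  map_add' x y := by simp only [add_apply, mul_add, Finset.sum_add_distrib]
  map_smul' c x := by
    simp only [smul_apply, Finset.mul_sum, RingHom.id_apply, smul_eq_mul]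
    exact Finset.sum_congr rfl fun m _ => by ring

variable {k}

theorem adaptedCoord_ofList {l : ℕ} (hl : l < 52) (v : List (ℕ × ℤ)) :
    adaptedCoord k l (ofList k v) = (dot (adaptedForm l) v : k) := by
  have h := List.all_eq_true.1 adaptedForm_lt l (List.mem_range.2 hl)
  rw [dot_eq_sum, ← sum_coef (fun n => coef v n) (adaptedForm l)
    fun t ht => by simpa [Nat.blt_eq] using List.all_eq_true.1 h t ht]
  push_cast
  rfl

theorem finrank_lieF4 : Module.finrank k (LieF4 k) = 52 :=
  (Module.finrank_fintype_fun_eq_card k (η := Idx)).trans (by simp)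

variable [CharP k 3]

theorem adaptedCoord_adaptedVec (i j : Fin 52) :
    adaptedCoord k i (ofList k (adaptedVec j)) = if i = j then 1 else 0 := by
  have h := List.all_eq_true.1 (List.all_eq_true.1 adapted_dual i (List.mem_range.2 i.2)) j
    (List.mem_range.2 j.2)
  rw [modEq_iff k] at h
  rw [adaptedCoord_ofList i.2, h]
  by_cases hij : i = j
  · subst hij; simp
  · have : Nat.beq i j = false := by
      rw [← Bool.not_eq_true, Nat.beq_eq]
      exact fun h => hij (Fin.ext h)
    simp [hij, this]

variable (k) in
/-- The adapted basis of the Lie algebra of type `F₄`. -/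
noncomputable def adaptedBasis : Module.Basis (Fin 52) k (LieF4 k) :=
  basisOfLinearIndependentOfCardEqFinrank (b := fun i : Fin 52 => ofList k (adaptedVec i))
    (Fintype.linearIndependent_iff.2 fun c hc i => by
      have h := congrArg (adaptedCoord k i) hc
      simpa [adaptedCoord_adaptedVec] using h)
    (by rw [finrank_lieF4, Fintype.card_fin])

theorem adaptedBasis_apply (i : Fin 52) : adaptedBasis k i = ofList k (adaptedVec i) := by
  simp [adaptedBasis]

theorem adaptedBasis_repr (x : LieF4 k) (l : Fin 52) :
    (adaptedBasis k).repr x l = adaptedCoord k l x := by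
  have h : (adaptedBasis k).coord l = adaptedCoord k l := by
    refine (adaptedBasis k).ext fun i => ?_
    rw [Module.Basis.coord_apply, Module.Basis.repr_self, adaptedBasis_apply,
      adaptedCoord_adaptedVec, Finsupp.single_apply]
    simp only [eq_comm]
  exact LinearMap.congr_fun h x

theorem adaptedBasis_zero : adaptedBasis k 0 = nilpRep k := by
  rw [adaptedBasis_apply]
  ext l
  simp only [nilpRep, rootVec_eq_ofList, add_apply, ofList_apply, ← Int.cast_add, ← coef_append]
  rfl

theorem isAdapted_adaptedBasis : IsAdapted (adaptedBasis k) where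
  repr_lie i j l := by
    have h : ∀ i : Fin 52, ∀ t ∈ adaptedVec i, t.1 < 52 := fun i t ht => by
      have := List.all_eq_true.1 adaptedVec_lt i (List.mem_range.2 i.2)
      simpa [Nat.blt_eq] using List.all_eq_true.1 this t ht
    rw [adaptedBasis_apply, adaptedBasis_apply, lie_ofList (h i) (h j), adaptedBasis_repr,
      adaptedCoord_ofList l.2]
    rfl

/-- Every element of the orbit is the first vector of a basis with the structure constants of the
adapted basis. -/
theorem exists_isAdapted {e : LieF4 k} (he : e ∈ orbitA2tA1 k) :
    ∃ b : Module.Basis (Fin 52) k (LieF4 k), IsAdapted b ∧ b 0 = e := by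
  obtain ⟨g, hg, rfl⟩ := he
  refine ⟨(adaptedBasis k).map g, ⟨fun i j l => ?_⟩, by
    rw [Module.Basis.map_apply, adaptedBasis_zero]⟩
  rw [Module.Basis.map_apply, Module.Basis.map_apply, ← chevalleyGroup_map_lie hg]
  simp [isAdapted_adaptedBasis.repr_lie]

end Basis

/-! ### Parabolic subalgebras have dimension at least `28` -/

/-- A standard parabolic subalgebra contains the torus and the positive root vectors. -/
theorem le_finrank_of_isParabolic {k : Type*} [Field k] {S : LieSubalgebra k (LieF4 k)}
    (hS : IsParabolic S) : 28 ≤ Module.finrank k S := by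
  obtain ⟨g, -, J, hS⟩ := hS
  have : FiniteDimensional k (LieF4 k) :=
    Module.finite_of_finrank_pos (by rw [finrank_lieF4]; omega)
  have h1 : Module.finrank k S = Module.finrank k (stdParabolic k J) := by
    change Module.finrank k S.toSubmodule = _
    rw [hS]
    exact LinearEquiv.finrank_map_eq g _
  have hli : LinearIndependent k (chev k) := by
    refine Fintype.linearIndependent_iff.2 fun c hc i => ?_
    exact congrFun ((sum_chev c).symm.trans hc) i
  let f : Fin 24 ⊕ Fin 4 → Idx := Sum.map Sum.inl id
  have hf : Function.Injective f := Sum.map_injective.2 ⟨Sum.inl_injective, Function.injective_id⟩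
  have h2 := finrank_span_eq_card (hli.comp f hf)
  have pos : ∀ (i : Fin 24) (j : Fin 4), 0 ≤ coord (.inl i) j := by decide +kernel
  rw [h1]
  calc 28 = Module.finrank k (Submodule.span k (Set.range (chev k ∘ f))) := by rw [h2]; simp
    _ ≤ _ := Submodule.finrank_mono ?_
  rw [Submodule.span_le]
  rintro _ ⟨i | i, rfl⟩
  · refine Submodule.subset_span (Or.inr ⟨.inl i, fun j _ => ?_, ?_⟩)
    · exact pos i j
    · exact (rootVec_eq_chev _).symm
  · refine Submodule.subset_span (Or.inl ⟨i, ?_⟩)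
    ext l
    change _ = chev k (Sum.inr i) l
    rw [chev_apply]
    by_cases h : l = Sum.inr i
    · subst h; simp [torVec]
    · rw [if_neg (Ne.symm h)]; simp [torVec, h]

end LieF4

/-! ### The flag of an adapted basis -/

section Flag

open F4

variable {k L : Type*} [Field k] [LieRing L] [LieAlgebra k L]

/-- The span of `b₀, …, b_{n-1}`, given by the vanishing of the other coordinates.  For an adapted
basis, `n = 8` gives the radical `A`, and `n = 26` its normaliser. -/
def initialSpan (b : Module.Basis (Fin 52) k L) (n : ℕ) : Submodule k L where
  carrier := {x | ∀ i : Fin 52, n ≤ i → b.repr x i = 0}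
  add_mem' {x y} hx hy i hi := by
    rw [map_add, Finsupp.add_apply, hx i hi, hy i hi, add_zero]
  zero_mem' i _ := by rw [map_zero, Finsupp.zero_apply]
  smul_mem' c x hx i hi := by rw [map_smul, Finsupp.smul_apply, hx i hi, smul_zero]

variable {b : Module.Basis (Fin 52) k L}

theorem mem_initialSpan {n : ℕ} {x : L} :
    x ∈ initialSpan b n ↔ ∀ i : Fin 52, n ≤ i → b.repr x i = 0 := Iff.rfl

theorem basis_mem_initialSpan {n : ℕ} {i : Fin 52} : b i ∈ initialSpan b n ↔ (i : ℕ) < n := by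
  rw [mem_initialSpan]
  constructor
  · intro h
    by_contra hi
    simpa using h i (not_lt.1 hi)
  · intro h j hj
    rw [b.repr_self, Finsupp.single_apply, if_neg]
    rintro rfl
    omega

theorem initialSpan_mono {m n : ℕ} (h : m ≤ n) : initialSpan b m ≤ initialSpan b n :=
  fun _ hx i hi => hx i (h.trans hi)

theorem initialSpan_eq_span (n : ℕ) :
    initialSpan b n = Submodule.span k (b '' {i | (i : ℕ) < n}) := by
  ext x
  rw [b.mem_span_image, mem_initialSpan]
  constructor
  · intro h i hi
    by_contra hn
    exact Finsupp.mem_support_iff.1 hi (h i (not_lt.1 hn))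
  · intro h i hi
    by_contra hn
    exact absurd (h (Finsupp.mem_support_iff.2 hn)) (not_lt.2 hi)

theorem finrank_initialSpan {n : ℕ} (hn : n ≤ 52) : Module.finrank k (initialSpan b n) = n := by
  have h : b '' {i | (i : ℕ) < n} = Set.range (b ∘ Fin.castLE hn) := by
    ext x
    constructor
    · rintro ⟨i, hi, rfl⟩
      exact ⟨⟨i, hi⟩, rfl⟩
    · rintro ⟨i, rfl⟩
      exact ⟨Fin.castLE hn i, i.2, rfl⟩
  rw [initialSpan_eq_span, h,
    finrank_span_eq_card (b.linearIndependent.comp _ (Fin.castLE_injective hn)), Fintype.card_fin]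

/-- A vector outside `initialSpan b n` has a leading coordinate of index at least `n`. -/
theorem exists_leading {n : ℕ} {x : L} (hx : x ∉ initialSpan b n) :
    ∃ t : Fin 52, n ≤ t ∧ b.repr x t ≠ 0 ∧ ∀ j, t < j → b.repr x j = 0 := by
  rw [mem_initialSpan] at hx
  push Not at hx
  obtain ⟨i, hi, hne⟩ := hx
  obtain ⟨t, ht, hmax⟩ := (b.repr x).support.exists_max_image id
    ⟨i, Finsupp.mem_support_iff.2 hne⟩
  refine ⟨t, hi.trans (hmax i (Finsupp.mem_support_iff.2 hne)), Finsupp.mem_support_iff.1 ht,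
    fun j hj => ?_⟩
  by_contra hj'
  exact absurd (hmax j (Finsupp.mem_support_iff.2 hj')) (not_le.2 hj)

namespace IsAdapted

theorem repr_basis_lie (hb : IsAdapted b) (i : Fin 52) (x : L) (l : Fin 52) :
    b.repr ⁅b i, x⁆ l = ∑ j, b.repr x j * (structConst i j l : k) := by
  have h : ⁅b i, x⁆ = ∑ j, b.repr x j • ⁅b i, b j⁆ := by
    conv_lhs => rw [← b.sum_repr x]
    simp only [lie_sum, lie_smul]
  rw [h, map_sum, Finsupp.finsetSum_apply]
  exact Finset.sum_congr rfl fun j _ => by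
    rw [map_smul, Finsupp.smul_apply, hb.repr_lie, smul_eq_mul]

/-- A coordinate of `⁅b_u, x⁆` that only depends on the leading coordinate of `x`. -/
theorem repr_lie_leading (hb : IsAdapted b) {u t r : Fin 52} {x : L}
    (hx : ∀ j, t < j → b.repr x j = 0) (h : ∀ j < t, (structConst u j r : k) = 0) :
    b.repr ⁅b u, x⁆ r = b.repr x t * (structConst u t r : k) := by
  rw [hb.repr_basis_lie, Finset.sum_eq_single t]
  · intro j _ hj
    rcases lt_or_gt_of_ne hj with hj | hj
    · rw [h j hj, mul_zero]
    · rw [hx j hj, zero_mul]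
  · exact fun h => absurd (Finset.mem_univ t) h

theorem induction_initialSpan {n : ℕ} {V : Type*} [AddCommGroup V] [Module k V] {f g : L →ₗ[k] V}
    (h : ∀ i : Fin 52, (i : ℕ) < n → f (b i) = g (b i)) {x : L} (hx : x ∈ initialSpan b n) :
    f x = g x := by
  rw [initialSpan_eq_span] at hx
  exact LinearMap.eqOn_span (by rintro _ ⟨i, hi, rfl⟩; exact h i hi) hx

theorem lie_mem_of_basis {m n q : ℕ}
    (h : ∀ i j : Fin 52, (i : ℕ) < m → (j : ℕ) < n → ⁅b i, b j⁆ ∈ initialSpan b q) {x y : L}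
    (hx : x ∈ initialSpan b m) (hy : y ∈ initialSpan b n) : ⁅x, y⁆ ∈ initialSpan b q := by
  rw [initialSpan_eq_span] at hx hy
  induction hx, hy using Submodule.span_induction₂ with
  | mem_mem x y hx hy =>
    obtain ⟨i, hi, rfl⟩ := hx
    obtain ⟨j, hj, rfl⟩ := hy
    exact h i j hi hj
  | zero_left => rw [zero_lie]; exact zero_mem _
  | zero_right => rw [lie_zero]; exact zero_mem _
  | add_left _ _ _ _ _ _ h1 h2 => rw [add_lie]; exact add_mem h1 h2
  | add_right _ _ _ _ _ _ h1 h2 => rw [lie_add]; exact add_mem h1 h2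
  | smul_left c _ _ _ _ h => rw [smul_lie]; exact Submodule.smul_mem _ c h
  | smul_right c _ _ _ _ h => rw [lie_smul]; exact Submodule.smul_mem _ c h

variable [CharP k 3]

theorem structConst_eq {i a : Fin 52} (hi : (i : ℕ) < 26) (ha : (a : ℕ) < 8) (l : Fin 52) :
    (structConst i a l : k) = if (i : ℕ) < 8 then 0 else (twistedCoeff i a l : k) := by
  have h := List.all_eq_true.1 (List.all_eq_true.1 (List.all_eq_true.1 structConst_action i
    (List.mem_range.2 hi)) a (List.mem_range.2 ha)) l (List.mem_range.2 l.2)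
  rw [modEq_iff k] at h
  rw [h]
  by_cases h8 : (i : ℕ) < 8
  · rw [if_pos h8, show Nat.blt i 8 = true by rw [Nat.blt_eq]; exact h8]
    simp
  · rw [if_neg h8, show Nat.blt i 8 = false from by
      rw [← Bool.not_eq_true, Nat.blt_eq]; exact h8]
    simp

theorem structConst_eq_zero {i a : Fin 52} (hi : (i : ℕ) < 26) (ha : (a : ℕ) < 8) {l : Fin 52}
    (hl : 8 ≤ (l : ℕ)) : (structConst i a l : k) = 0 := by
  rw [structConst_eq hi ha]
  split_ifs with h8
  · rfl
  have h := List.all_eq_true.1 (List.all_eq_true.1 (List.all_eq_true.1 twistedCoeff_of_le i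
    (List.mem_range.2 hi)) a (List.mem_range.2 ha)) l (List.mem_range.2 l.2)
  simp only [Bool.or_eq_true, Nat.blt_eq] at h
  rw [modEq_iff k] at h
  rcases h with (h | h) | h
  · omega
  · omega
  · rw [h, Int.cast_zero]

theorem lie_mem (hb : IsAdapted b) {x y : L} (hx : x ∈ initialSpan b 26)
    (hy : y ∈ initialSpan b 8) : ⁅x, y⁆ ∈ initialSpan b 8 := by
  refine lie_mem_of_basis (fun i j hi hj l hl => ?_) hx hy
  rw [hb.repr_lie, structConst_eq_zero hi hj hl]

theorem lie_eq_zero (hb : IsAdapted b) {x y : L} (hx : x ∈ initialSpan b 8)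
    (hy : y ∈ initialSpan b 8) : ⁅x, y⁆ = 0 := by
  have h : ⁅x, y⁆ ∈ initialSpan b 0 := by
    refine lie_mem_of_basis (fun i j hi hj l _ => ?_) hx hy
    rw [hb.repr_lie, structConst_eq (by omega) hj, if_pos hi]
  exact b.ext_elem fun i => by rw [h i (Nat.zero_le _), map_zero, Finsupp.zero_apply]

/-- `ad b₀` is injective from the quotient by `initialSpan b 26` to the quotient by
`initialSpan b 8`, by triangularity. -/
theorem mem_of_lie_mem (hb : IsAdapted b) {x : L} (h : ⁅b 0, x⁆ ∈ initialSpan b 8) :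
    x ∈ initialSpan b 26 := by
  by_contra hx
  obtain ⟨t, ht, hne, hlead⟩ := exists_leading hx
  have hp := List.all_eq_true.1 structConst_pivot t (List.mem_range.2 t.2)
  simp only [Bool.or_eq_true, Bool.and_eq_true, Nat.blt_eq, Nat.ble_eq, List.all_eq_true,
    List.mem_range, Bool.not_eq_true'] at hp
  obtain ⟨⟨h1, h2⟩, h3⟩ := hp.resolve_left (by omega)
  have hlt := pivot_lt t
  have h4 := hb.repr_lie_leading (u := 0) (r := ⟨pivot t, hlt⟩) hlead
    fun j hj => by simpa using (modEq_iff k _ _).1 (h3 j hj)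
  rw [h _ h1, eq_comm, mul_eq_zero] at h4
  have h5 := (modEq_iff k _ _).2 ((h4.resolve_left hne).trans Int.cast_zero.symm)
  exact absurd (h2.symm.trans h5) Bool.false_ne_true

/-- The normaliser of `A`.  Membership in it is already detected by the bracket with `b₀`. -/
theorem normalizerOf_eq (hb : IsAdapted b) :
    (normalizerOf (initialSpan b 8)).toSubmodule = initialSpan b 26 := by
  ext x
  constructor
  · intro hx
    refine hb.mem_of_lie_mem ?_
    rw [← lie_skew]
    exact neg_mem (hx (b 0) (basis_mem_initialSpan.2 (by simp)))
  · intro hx v hv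
    exact hb.lie_mem hx hv

/-! ### Maximality -/

/-- A subalgebra that contains the normaliser of `A` properly contains `b₂₆`: lowering operators decrease the leading index of a vector outside the normaliser. -/
theorem basis_mem_of_gt (hb : IsAdapted b) {M : LieSubalgebra k L}
    (hM : initialSpan b 26 ≤ M.toSubmodule) {x : L} (hx : x ∈ M) (hx' : x ∉ initialSpan b 26) :
    b 26 ∈ M := by
  obtain ⟨t, ht, hne, hlead⟩ := exists_leading hx'
  induction hn : (t : ℕ) using Nat.strong_induction_on generalizing x t with
  | _ n ih =>
  subst hn
  rcases ht.eq_or_lt with ht | ht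
  · obtain rfl : t = 26 := Fin.ext ht.symm
    have h : x - b.repr x 26 • b 26 ∈ M := by
      refine hM fun i hi => ?_
      rw [map_sub, map_smul, b.repr_self, Finsupp.sub_apply, Finsupp.smul_apply,
        Finsupp.single_apply]
      split_ifs with h
      · rw [h]; simp
      · rw [hlead i (lt_of_le_of_ne (Fin.le_def.2 hi) h)]; simp
    have h' := M.sub_mem hx h
    rw [sub_sub_cancel] at h'
    simpa [smul_smul, hne] using M.smul_mem (b.repr x 26)⁻¹ h'
  · have hp := List.all_eq_true.1 structConst_lowerTo t (List.mem_range.2 t.2)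
    simp only [Bool.or_eq_true, Bool.and_eq_true, Nat.ble_eq, List.all_eq_true,
      List.mem_range, Bool.not_eq_true'] at hp
    obtain ⟨⟨h1, h2⟩, h3⟩ := hp.resolve_left (by omega)
    have hu : lowerOp t ∈ [0, 8, 9, 10] ∧ lowerOp t < 26 := by
      unfold lowerOp; split_ifs <;> simp
    have hlt := lowerTo_lt t
    have h4 := hb.repr_lie_leading (u := ⟨lowerOp t, by omega⟩) (r := ⟨lowerTo t, hlt⟩) hlead
      fun j hj => by simpa using (modEq_iff k _ _).1 (h3 j hj)
    have h5 : b.repr ⁅b ⟨lowerOp t, by omega⟩, x⁆ ⟨lowerTo t, hlt⟩ ≠ 0 := by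
      rw [h4]
      refine mul_ne_zero hne fun h => ?_
      have h5 := (modEq_iff k _ _).2 (h.trans Int.cast_zero.symm)
      exact absurd (h2.symm.trans h5) Bool.false_ne_true
    have h6 : ⁅b ⟨lowerOp t, by omega⟩, x⁆ ∉ initialSpan b 26 := fun h => h5 (h _ h1)
    have h7 : ⁅b ⟨lowerOp t, by omega⟩, x⁆ ∈ M :=
      M.lie_mem (hM (basis_mem_initialSpan.2 hu.2)) hx
    obtain ⟨s, hs, hsne, hslead⟩ := exists_leading h6
    refine ih s ?_ h7 h6 s hs hsne hslead rfl
    by_contra hst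
    refine hsne ?_
    rw [hb.repr_basis_lie]
    refine Finset.sum_eq_zero fun j _ => ?_
    by_cases hj : t < j
    · rw [hlead j hj, zero_mul]
    · have hz := List.all_eq_true.1 (List.all_eq_true.1 structConst_lower _ hu.1) s
        (List.mem_range.2 s.2)
      simp only [Bool.or_eq_true, Nat.blt_eq, List.all_eq_true, List.mem_range] at hz
      have := hz.resolve_left (by omega) j (by omega)
      rw [modEq_iff k, Int.cast_zero] at this
      rw [this, mul_zero]

/-- A verified list of triples certifies that basis vectors lie in `M`: every bracket in the list
produces one new basis vector, up to vectors that are known to lie in `M`. -/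
theorem mem_of_raiseOK (hb : IsAdapted b) {M : LieSubalgebra k L} (r : List (ℕ × ℕ × ℕ)) :
    ∀ known : List ℕ, (∀ i ∈ known, ∃ h : i < 52, b ⟨i, h⟩ ∈ M) → raiseOK known r = true →
      ∀ s ∈ r, ∃ h : s.1 < 52, b ⟨s.1, h⟩ ∈ M := by
  induction r with
  | nil => simp
  | cons t r ih =>
    intro known hk h
    simp only [raiseOK, Bool.and_eq_true, Nat.blt_eq, List.contains_iff_mem, List.all_eq_true,
      Bool.or_eq_true, Bool.not_eq_true', List.mem_range, Nat.beq_eq] at h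
    obtain ⟨⟨⟨⟨⟨h1, h2⟩, h3⟩, h4⟩, h5⟩, h6⟩ := h
    have ht : ∃ h : t.1 < 52, b ⟨t.1, h⟩ ∈ M := by
      refine ⟨h1, ?_⟩
      obtain ⟨hi, hiM⟩ := hk _ h2
      obtain ⟨hj, hjM⟩ := hk _ h3
      have hM := M.lie_mem hiM hjM
      set c : k := ((structConst t.2.1 t.2.2 t.1 : ℤ) : k)
      have hc : c ≠ 0 := fun h => by
        have h' := (modEq_iff k _ _).2 (h.trans Int.cast_zero.symm)
        exact absurd (h4.symm.trans h') Bool.false_ne_true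
      rw [← b.sum_repr ⁅b ⟨t.2.1, hi⟩, b ⟨t.2.2, hj⟩⁆,
        ← Finset.add_sum_erase _ _ (Finset.mem_univ (⟨t.1, h1⟩ : Fin 52)), hb.repr_lie] at hM
      have hrest : ∑ l ∈ Finset.univ.erase (⟨t.1, h1⟩ : Fin 52),
          b.repr ⁅b ⟨t.2.1, hi⟩, b ⟨t.2.2, hj⟩⁆ l • b l ∈ M := by
        refine M.toSubmodule.sum_mem fun l hl => ?_
        rw [hb.repr_lie]
        rcases h5 l l.2 with (h | h) | h
        · exact absurd (Fin.ext h) (Finset.ne_of_mem_erase hl)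
        · exact M.smul_mem _ (hk _ h).2
        · rw [(modEq_iff k _ _).1 h, Int.cast_zero, zero_smul]
          exact M.zero_mem
      have h' := M.sub_mem hM hrest
      rw [add_sub_cancel_right] at h'
      simpa [smul_smul, hc, c] using M.smul_mem c⁻¹ h'
    intro s hs
    rcases List.mem_cons.1 hs with rfl | hs
    · exact ht
    · refine ih (t.1 :: known) (fun i hi => ?_) h6 s hs
      rcases List.mem_cons.1 hi with rfl | hi
      · exact ht
      · exact hk i hi

/-- The normaliser of `A` is maximal: a larger subalgebra contains `b₂₆`, which generates the whole
Lie algebra together with the normaliser. -/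
theorem isCoatom (hb : IsAdapted b) {w : LieSubalgebra k L}
    (hw : w.toSubmodule = initialSpan b 26) : IsCoatom w := by
  constructor
  · rintro rfl
    have h : b 26 ∈ initialSpan b 26 := by rw [← hw]; exact Submodule.mem_top
    exact absurd (basis_mem_initialSpan.1 h) (by simp)
  · intro M hM
    have hle : initialSpan b 26 ≤ M.toSubmodule := by rw [← hw]; exact hM.le
    obtain ⟨x, hx, hxw⟩ := SetLike.exists_of_lt hM
    have h26 := hb.basis_mem_of_gt hle hx fun h => hxw (by rw [← hw] at h; exact h)
    have hknown : ∀ i ∈ List.range 27, ∃ h : i < 52, b ⟨i, h⟩ ∈ M := by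
      intro i hi
      rw [List.mem_range] at hi
      refine ⟨by omega, ?_⟩
      rcases Nat.lt_succ_iff_lt_or_eq.1 hi with hi | rfl
      · exact hle (basis_mem_initialSpan.2 hi)
      · exact h26
    have hall : ∀ l, b l ∈ M := by
      intro l
      have h := List.all_eq_true.1 raising_all l (List.mem_range.2 l.2)
      simp only [Bool.or_eq_true, Nat.blt_eq, List.any_eq_true, Nat.beq_eq] at h
      rcases h with h | ⟨s, hs, hl⟩
      · exact (hknown l (List.mem_range.2 h)).2
      · obtain ⟨h1, h2⟩ := hb.mem_of_raiseOK raising _ hknown raising_ok s hs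
        have : l = ⟨s.1, h1⟩ := Fin.ext hl.symm
        rw [this]
        exact h2
    rw [eq_top_iff]
    intro y _
    rw [← b.sum_repr y]
    exact M.toSubmodule.sum_mem fun l _ => M.smul_mem _ (hall l)

end IsAdapted

end Flag

/-! ### The truncated polynomial ring in two variables over a field of characteristic three -/

namespace TruncPoly

section Monomials

/-- The ideal `(x_i ^ p)` contains no polynomial with a monomial of exponents less than `p`. -/
theorem coeff_eq_zero_of_mem_truncIdeal {p m : ℕ} {k : Type*} [Field k]
    {f : MvPolynomial (Fin m) k} (hf : f ∈ truncIdeal p m k) (s : Fin m →₀ ℕ)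
    (hs : ∀ i, s i < p) : MvPolynomial.coeff s f = 0 := by
  induction hf using Submodule.span_induction generalizing s with
  | mem f h =>
    obtain ⟨i, rfl⟩ := h
    rw [MvPolynomial.coeff_X_pow, if_neg]
    rintro rfl
    simpa using hs i
  | zero => exact MvPolynomial.coeff_zero s
  | add f g _ _ hf hg => rw [MvPolynomial.coeff_add, hf s hs, hg s hs, add_zero]
  | smul a f _ hf =>
    rw [smul_eq_mul, MvPolynomial.coeff_mul]
    refine Finset.sum_eq_zero fun uv huv => ?_
    rw [hf uv.2 fun i => lt_of_le_of_lt ?_ (hs i), mul_zero]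
    rw [← Finset.HasAntidiagonal.mem_antidiagonal.1 huv]
    exact Nat.le_add_left _ _

variable {k : Type*} [Field k]

/-- The monomial `x₁ⁱ x₂ʲ`. -/
noncomputable def mono (k : Type*) [Field k] (i j : ℕ) : TruncPoly 3 2 k :=
  x 3 2 k 0 ^ i * x 3 2 k 1 ^ j

theorem x_cube (i : Fin 2) : x 3 2 k i ^ 3 = 0 := by
  rw [x, ← map_pow, Ideal.Quotient.eq_zero_iff_mem]
  exact Ideal.subset_span ⟨i, rfl⟩

theorem mono_mul (i j p q : ℕ) : mono k i j * mono k p q = mono k (i + p) (j + q) := by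
  unfold mono; ring

theorem mono_zero_zero : mono k 0 0 = 1 := by simp [mono]

theorem mono_one_zero : mono k 1 0 = x 3 2 k 0 := by simp [mono]

theorem mono_zero_one : mono k 0 1 = x 3 2 k 1 := by simp [mono]

theorem mono_eq_zero {i j : ℕ} (h : 3 ≤ i ∨ 3 ≤ j) : mono k i j = 0 := by
  rcases h with h | h <;> obtain ⟨n, rfl⟩ := Nat.exists_eq_add_of_le h <;>
    simp [mono, pow_add, x_cube]

theorem mono_eq_mk (i j : ℕ) : mono k i j = Ideal.Quotient.mk (truncIdeal 3 2 k)
    (MvPolynomial.monomial (Finsupp.single 0 i + Finsupp.single 1 j) 1) := by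
  rw [← one_mul (1 : k), ← MvPolynomial.monomial_mul, map_mul, mono, x, x, ← map_pow, ← map_pow,
    MvPolynomial.X_pow_eq_monomial, MvPolynomial.X_pow_eq_monomial]

theorem mono_linearIndependent {c : Fin 3 → Fin 3 → k}
    (hc : ∑ i : Fin 3, ∑ j : Fin 3, c i j • mono k i j = 0) : ∀ i j, c i j = 0 := by
  intro p q
  have h : Ideal.Quotient.mk (truncIdeal 3 2 k) (∑ i : Fin 3, ∑ j : Fin 3,
      c i j • MvPolynomial.monomial (Finsupp.single 0 (i : ℕ) + Finsupp.single 1 (j : ℕ)) (1 : k))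
        = 0 := by
    rw [← hc]
    simp only [map_sum, mono_eq_mk]
    rfl
  rw [Ideal.Quotient.eq_zero_iff_mem] at h
  have h' := coeff_eq_zero_of_mem_truncIdeal h
    (Finsupp.single 0 (p : ℕ) + Finsupp.single 1 (q : ℕ)) (fun i => by fin_cases i <;> simp)
  have hinj : ∀ i j : Fin 3, (Finsupp.single (0 : Fin 2) (i : ℕ) + Finsupp.single 1 (j : ℕ) =
      Finsupp.single 0 (p : ℕ) + Finsupp.single 1 (q : ℕ)) ↔ (i = p ∧ j = q) := by
    intro i j
    refine ⟨fun h => ⟨?_, ?_⟩, by rintro ⟨rfl, rfl⟩; rfl⟩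
    · have := DFunLike.congr_fun h 0
      simpa [Fin.val_inj] using this
    · have := DFunLike.congr_fun h 1
      simpa [Fin.val_inj] using this
  simpa [MvPolynomial.coeff_sum, MvPolynomial.coeff_monomial, hinj, ite_and] using h'

theorem eq_zero_of_smul_one_eq_zero {a : k} (h : a • (1 : TruncPoly 3 2 k) = 0) : a = 0 := by
  have := mono_linearIndependent (c := fun i j => if i = 0 ∧ j = 0 then a else 0)
    (by simpa [Fin.sum_univ_three, mono_zero_zero] using h) 0 0
  simpa using this

theorem exists_eq_sum_mono (f : TruncPoly 3 2 k) :
    ∃ c : Fin 3 → Fin 3 → k, f = ∑ i : Fin 3, ∑ j : Fin 3, c i j • mono k i j := by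
  have key : ∀ f : TruncPoly 3 2 k,
      f ∈ Submodule.span k (Set.range fun t : Fin 3 × Fin 3 => mono k t.1 t.2) := by
    intro f
    obtain ⟨f, rfl⟩ := Ideal.Quotient.mk_surjective f
    induction f using MvPolynomial.induction_on' with
    | monomial s a =>
      have hs : s = Finsupp.single 0 (s 0) + Finsupp.single 1 (s 1) := by
        ext i; fin_cases i <;> simp
      have h : Ideal.Quotient.mk (truncIdeal 3 2 k) (MvPolynomial.monomial s a) =
          a • mono k (s 0) (s 1) := by
        rw [mono_eq_mk, ← hs]
        have : MvPolynomial.monomial s a = a • MvPolynomial.monomial s (1 : k) := by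
          rw [MvPolynomial.smul_monomial, smul_eq_mul, mul_one]
        rw [this]
        rfl
      rw [h]
      refine Submodule.smul_mem _ a ?_
      by_cases h0 : s 0 < 3 ∧ s 1 < 3
      · exact Submodule.subset_span ⟨(⟨s 0, h0.1⟩, ⟨s 1, h0.2⟩), rfl⟩
      · rw [mono_eq_zero (by omega)]
        exact zero_mem _
    | add f g hf hg => rw [map_add]; exact add_mem hf hg
  obtain ⟨c, hc⟩ := (Submodule.mem_span_range_iff_exists_fun k).1 (key f)
  refine ⟨fun i j => c (i, j), ?_⟩
  rw [← hc, Fintype.sum_prod_type]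

end Monomials

section Derivatives

variable {k : Type*} [Field k] [CharP k 3]

theorem partialD_zero_mono (i j : ℕ) :
    partialD 3 2 k 0 (mono k i j) = (i : k) • mono k (i - 1) j := by
  rw [mono, Derivation.leibniz, Derivation.leibniz_pow, Derivation.leibniz_pow, partialD_x,
    partialD_x]
  simp only [zero_ne_one, if_true, if_false, mul_zero, mul_one, zero_add, smul_eq_mul,
    mono, Nat.cast_smul_eq_nsmul, nsmul_eq_mul]
  ring

theorem partialD_one_mono (i j : ℕ) :
    partialD 3 2 k 1 (mono k i j) = (j : k) • mono k i (j - 1) := by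
  rw [mono, Derivation.leibniz, Derivation.leibniz_pow, Derivation.leibniz_pow, partialD_x,
    partialD_x]
  simp only [one_ne_zero, if_true, if_false, mul_zero, mul_one, add_zero, smul_eq_mul,
    mono, Nat.cast_smul_eq_nsmul, nsmul_eq_mul]
  ring

theorem partialD_cube (d : Fin 2) (f : TruncPoly 3 2 k) :
    partialD 3 2 k d (partialD 3 2 k d (partialD 3 2 k d f)) = 0 := by
  obtain ⟨c, rfl⟩ := exists_eq_sum_mono f
  fin_cases d
  · simp [Fin.sum_univ_three, partialD_zero_mono]
  · simp [Fin.sum_univ_three, partialD_one_mono]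

/-- An element with zero partial derivatives is constant. -/
theorem exists_eq_smul_one {f : TruncPoly 3 2 k} (h : ∀ d, partialD 3 2 k d f = 0) :
    ∃ a : k, f = a • 1 := by
  obtain ⟨c, rfl⟩ := exists_eq_sum_mono f
  have h0 := mono_linearIndependent (c := fun i j => ![c 1 j, 2 * c 2 j, 0] i) (by
    rw [← h 0]
    simp [Fin.sum_univ_three, partialD_zero_mono, smul_smul, mul_comm])
  have h1 := mono_linearIndependent (c := fun i j => ![c i 1, 2 * c i 2, 0] j) (by
    rw [← h 1]
    simp [Fin.sum_univ_three, partialD_one_mono, smul_smul, mul_comm])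
  have e1 : ∀ j, c 1 j = 0 := fun j => by simpa using h0 0 j
  have e2 : ∀ j, c 2 j = 0 := fun j => by simpa [two_ne_zero_of_charP_three] using h0 1 j
  have e3 : ∀ i, c i 1 = 0 := fun i => by simpa using h1 i 0
  have e4 : ∀ i, c i 2 = 0 := fun i => by simpa [two_ne_zero_of_charP_three] using h1 i 1
  exact ⟨c 0 0, by simp [Fin.sum_univ_three, e1, e2, e3, e4, mono_zero_zero]⟩

end Derivatives

end TruncPoly

/-! ### Ideals of subalgebras of `W(2; 1)` that contain `H(2; 1)` -/

section Witt

open TruncPoly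

variable {k : Type*} [Field k] [CharP k 3]

/-- The derivation `x₁ⁱ x₂ʲ ∂_{d + 1}`. -/
noncomputable def wittMono (k : Type*) [Field k] [CharP k 3] (i j : ℕ) (d : Fin 2) :
    WittAlgebra 3 2 k :=
  mono k i j • partialD 3 2 k d

theorem wittMono_apply (i j : ℕ) (d : Fin 2) (f : TruncPoly 3 2 k) :
    wittMono k i j d f = mono k i j * partialD 3 2 k d f := rfl

theorem wittMono_x (i j : ℕ) (d l : Fin 2) :
    wittMono k i j d (x 3 2 k l) = if d = l then mono k i j else 0 := by
  rw [wittMono_apply, partialD_x]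
  split_ifs <;> simp

theorem divergence_wittMono (i j : ℕ) (d : Fin 2) :
    divergence (wittMono k i j d) = partialD 3 2 k d (mono k i j) := by
  rw [divergence, Finset.sum_eq_single d]
  · rw [wittMono_x, if_pos rfl]
  · intro l _ hl
    rw [wittMono_x, if_neg hl.symm, map_zero]
  · exact fun h => absurd (Finset.mem_univ d) h

theorem wittMono_mem_hamiltonian {i j : ℕ} {d : Fin 2}
    (h : partialD 3 2 k d (mono k i j) = 0) : wittMono k i j d ∈ hamiltonian 3 k := by
  rw [mem_hamiltonian, divergence_wittMono, h]

theorem wittMono_zero_zero (d : Fin 2) : wittMono k 0 0 d = partialD 3 2 k d := by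
  rw [wittMono, mono_zero_zero, one_smul]

theorem partialD_mem_hamiltonian (d : Fin 2) : partialD 3 2 k d ∈ hamiltonian 3 k := by
  rw [← wittMono_zero_zero]
  refine wittMono_mem_hamiltonian ?_
  rw [mono_zero_zero, Derivation.map_one_eq_zero]

theorem partialD_lie_x (d : Fin 2) (D : WittAlgebra 3 2 k) (l : Fin 2) :
    ⁅partialD 3 2 k d, D⁆ (x 3 2 k l) = partialD 3 2 k d (D (x 3 2 k l)) := by
  rw [Derivation.commutator_apply, partialD_x]
  split_ifs <;> simp

/-- If the cube of `T` is zero, a nonzero subspace that `T` preserves meets the kernel of `T`. -/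
theorem exists_ne_zero_of_cube {V : Type*} [AddCommGroup V] (T : V → V)
    (hT : ∀ v, T (T (T v)) = 0) (P : V → Prop) (hP : ∀ v, P v → P (T v)) {v : V} (hv : P v)
    (h0 : v ≠ 0) : ∃ v, P v ∧ v ≠ 0 ∧ T v = 0 := by
  by_cases h1 : T v = 0
  · exact ⟨v, hv, h0, h1⟩
  by_cases h2 : T (T v) = 0
  · exact ⟨T v, hP v hv, h1, h2⟩
  · exact ⟨T (T v), hP _ (hP v hv), h2, hT v⟩

theorem partialD_lie_cube (d : Fin 2) (D : WittAlgebra 3 2 k) :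
    ⁅partialD 3 2 k d, ⁅partialD 3 2 k d, ⁅partialD 3 2 k d, D⁆⁆⁆ = 0 := by
  refine derivation_ext fun l => ?_
  rw [partialD_lie_x, partialD_lie_x, partialD_lie_x, partialD_cube, Derivation.zero_apply]

/-- A nonzero subspace of `W(2; 1)` that is stable under `H(2; 1)` contains `∂₁` and `∂₂`: bracket
with `∂₁` and `∂₂` to reach a nonzero combination `a ∂₁ + b ∂₂`, then use the action of
`x₁ ∂₂` and `x₂ ∂₁`. -/
theorem partialD_mem_of_stable {J : Submodule k (WittAlgebra 3 2 k)} (hJ : J ≠ ⊥)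
    (hs : ∀ E ∈ hamiltonian 3 k, ∀ D ∈ J, ⁅E, D⁆ ∈ J) (d : Fin 2) : partialD 3 2 k d ∈ J := by
  obtain ⟨D, hD, hne⟩ := Submodule.exists_mem_ne_zero_of_ne_bot hJ
  obtain ⟨D, hD, hne, hD0⟩ := exists_ne_zero_of_cube (fun D => ⁅partialD 3 2 k 0, D⁆)
    (partialD_lie_cube 0) (· ∈ J) (hs _ (partialD_mem_hamiltonian 0)) hD hne
  obtain ⟨D, ⟨hD, hD0⟩, hne, hD1⟩ := exists_ne_zero_of_cube (fun D => ⁅partialD 3 2 k 1, D⁆)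
    (partialD_lie_cube 1) (fun D => D ∈ J ∧ ⁅partialD 3 2 k 0, D⁆ = 0)
    (fun D hD => ⟨hs _ (partialD_mem_hamiltonian 1) D hD.1, by
      refine derivation_ext fun l => ?_
      rw [partialD_lie_x, partialD_lie_x, partialD_comm, ← partialD_lie_x, hD.2,
        Derivation.zero_apply, map_zero]⟩) ⟨hD, hD0⟩ hne
  have hconst : ∀ l, ∃ a : k, D (x 3 2 k l) = a • 1 := by
    intro l
    refine exists_eq_smul_one fun i => ?_
    rw [← partialD_lie_x]
    fin_cases i
    · exact (congrArg (fun E : WittAlgebra 3 2 k => E (x 3 2 k l)) hD0)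
    · exact (congrArg (fun E : WittAlgebra 3 2 k => E (x 3 2 k l)) hD1)
  obtain ⟨a, ha⟩ := hconst 0
  obtain ⟨b, hb⟩ := hconst 1
  have h01 : wittMono k 1 0 1 ∈ hamiltonian 3 k :=
    wittMono_mem_hamiltonian (by simp [partialD_one_mono])
  have h10 : wittMono k 0 1 0 ∈ hamiltonian 3 k :=
    wittMono_mem_hamiltonian (by simp [partialD_zero_mono])
  have e0 : ⁅wittMono k 1 0 1, D⁆ = -a • partialD 3 2 k 1 := by
    refine derivation_ext fun l => ?_
    rw [Derivation.commutator_apply, wittMono_x, wittMono_apply, Derivation.smul_apply, partialD_x]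
    fin_cases l
    · simp [ha]
    · simp [hb, mono_one_zero, ha]
  have e1 : ⁅wittMono k 0 1 0, D⁆ = -b • partialD 3 2 k 0 := by
    refine derivation_ext fun l => ?_
    rw [Derivation.commutator_apply, wittMono_x, wittMono_apply, Derivation.smul_apply, partialD_x]
    fin_cases l
    · simp [ha, mono_zero_one, hb]
    · simp [hb]
  have f0 : ⁅wittMono k 1 0 1, partialD 3 2 k 0⁆ = (-1 : k) • partialD 3 2 k 1 := by
    refine derivation_ext fun l => ?_
    rw [Derivation.commutator_apply, wittMono_x, wittMono_apply, Derivation.smul_apply, partialD_x,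
      partialD_x]
    fin_cases l <;> simp [mono_one_zero, partialD_x]
  have f1 : ⁅wittMono k 0 1 0, partialD 3 2 k 1⁆ = (-1 : k) • partialD 3 2 k 0 := by
    refine derivation_ext fun l => ?_
    rw [Derivation.commutator_apply, wittMono_x, wittMono_apply, Derivation.smul_apply, partialD_x,
      partialD_x]
    fin_cases l <;> simp [mono_zero_one, partialD_x]
  -- one of `a`, `b` is nonzero, so one of `∂₁`, `∂₂` lies in `J`, and then so does the other
  have step0 : partialD 3 2 k 0 ∈ J → partialD 3 2 k 1 ∈ J := fun h => by
    have := hs _ h01 _ h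
    rwa [f0, Submodule.smul_mem_iff _ (neg_ne_zero.2 one_ne_zero)] at this
  have step1 : partialD 3 2 k 1 ∈ J → partialD 3 2 k 0 ∈ J := fun h => by
    have := hs _ h10 _ h
    rwa [f1, Submodule.smul_mem_iff _ (neg_ne_zero.2 one_ne_zero)] at this
  have hab : a ≠ 0 ∨ b ≠ 0 := by
    by_contra! h
    refine hne (derivation_ext fun l => ?_)
    fin_cases l
    · simp [ha, h.1]
    · simp [hb, h.2]
  have hboth : partialD 3 2 k 0 ∈ J ∧ partialD 3 2 k 1 ∈ J := by
    rcases hab with h | h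
    · have h1 := hs _ h01 _ hD
      rw [e0, Submodule.smul_mem_iff _ (neg_ne_zero.2 h)] at h1
      exact ⟨step1 h1, h1⟩
    · have h1 := hs _ h10 _ hD
      rw [e1, Submodule.smul_mem_iff _ (neg_ne_zero.2 h)] at h1
      exact ⟨h1, step0 h1⟩
  fin_cases d
  · exact hboth.1
  · exact hboth.2

/-- A nonzero subspace of `W(2; 1)` that is stable under `H(2; 1)` is not abelian, as it contains
`∂₁` and `⁅∂₁, x₁² ∂₂⁆ = 2 x₁ ∂₂`. -/
theorem exists_lie_ne_zero_of_stable {J : Submodule k (WittAlgebra 3 2 k)} (hJ : J ≠ ⊥)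
    (hs : ∀ E ∈ hamiltonian 3 k, ∀ D ∈ J, ⁅E, D⁆ ∈ J) : ∃ D ∈ J, ∃ E ∈ J, ⁅D, E⁆ ≠ 0 := by
  have h0 := partialD_mem_of_stable hJ hs 0
  have h2 : wittMono k 2 0 1 ∈ hamiltonian 3 k :=
    wittMono_mem_hamiltonian (by simp [partialD_one_mono])
  refine ⟨_, h0, _, hs _ h2 _ h0, fun h => ?_⟩
  have h' := DFunLike.congr_fun h (x 3 2 k 1)
  rw [partialD_lie_x, Derivation.commutator_apply, wittMono_x, wittMono_apply, if_pos rfl,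
    partialD_zero_mono, partialD_x] at h'
  rw [if_neg zero_ne_one, map_zero, mul_zero, zero_sub, map_neg, Derivation.zero_apply, neg_eq_zero,
    Derivation.map_smul, partialD_zero_mono, smul_smul, mono_zero_zero] at h'
  have h'' := eq_zero_of_smul_one_eq_zero h'
  rw [Nat.cast_one, mul_one, Nat.cast_ofNat] at h''
  exact two_ne_zero_of_charP_three h''

end Witt

/-! ### The twisted action of `W(2; 1)` on the truncated polynomial ring -/

section Twisted

open TruncPoly

variable {k : Type*} [Field k] [CharP k 3]

/-- The action `D · f = D(f) + div(D) f` of `W(2; 1)`, as a bilinear map. -/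
noncomputable def twist (k : Type*) [Field k] [CharP k 3] :
    WittAlgebra 3 2 k →ₗ[k] TruncPoly 3 2 k →ₗ[k] TruncPoly 3 2 k :=
  LinearMap.mk₂ k (fun D f => D f + divergence D * f)
    (fun D E f => by rw [Derivation.add_apply, divergence_add]; ring)
    (fun c D f => by rw [Derivation.smul_apply, divergence_smul, smul_mul_assoc, smul_add])
    (fun D f g => by rw [map_add]; ring)
    (fun c D f => by rw [Derivation.map_smul, mul_smul_comm, smul_add])

theorem twist_apply (D : WittAlgebra 3 2 k) (f : TruncPoly 3 2 k) :
    twist k D f = D f + divergence D * f := rfl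

theorem twist_lie (D E : WittAlgebra 3 2 k) (f : TruncPoly 3 2 k) :
    twist k ⁅D, E⁆ f = twist k D (twist k E f) - twist k E (twist k D f) := by
  simp only [twist_apply, divergence_lie, Derivation.commutator_apply, map_add, Derivation.leibniz,
    smul_eq_mul]
  ring

theorem twist_one (D : WittAlgebra 3 2 k) : twist k D 1 = divergence D := by
  rw [twist_apply, Derivation.map_one_eq_zero, zero_add, mul_one]

/-- The twisted action is faithful: it is determined by the images of `1`, `x₁` and `x₂`. -/
theorem eq_of_twist_eq {D E : WittAlgebra 3 2 k} (h1 : twist k D 1 = twist k E 1)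
    (hx : ∀ i, twist k D (x 3 2 k i) = twist k E (x 3 2 k i)) : D = E := by
  rw [twist_one, twist_one] at h1
  refine derivation_ext fun i => ?_
  have h := hx i
  rwa [twist_apply, twist_apply, h1, add_left_inj] at h

theorem twist_wittMono_zero (i j p q : ℕ) :
    twist k (wittMono k i j 0) (mono k p q) = ((i + p : ℕ) : k) • mono k (i + p - 1) (j + q) := by
  rw [twist_apply, wittMono_apply, divergence_wittMono, partialD_zero_mono, partialD_zero_mono,
    mul_smul_comm, smul_mul_assoc, mono_mul, mono_mul, Nat.cast_add, add_smul, add_comm]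
  rcases i with - | i <;> rcases p with - | p
  · simp
  · simp
  · simp
  · rw [show i + 1 - 1 + (p + 1) = i + 1 + (p + 1) - 1 by omega,
      show i + 1 + (p + 1 - 1) = i + 1 + (p + 1) - 1 by omega]

theorem twist_wittMono_one (i j p q : ℕ) :
    twist k (wittMono k i j 1) (mono k p q) = ((j + q : ℕ) : k) • mono k (i + p) (j + q - 1) := by
  rw [twist_apply, wittMono_apply, divergence_wittMono, partialD_one_mono, partialD_one_mono,
    mul_smul_comm, smul_mul_assoc, mono_mul, mono_mul, Nat.cast_add, add_smul, add_comm]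
  rcases j with - | j <;> rcases q with - | q
  · simp
  · simp
  · simp
  · rw [show j + 1 - 1 + (q + 1) = j + 1 + (q + 1) - 1 by omega,
      show j + 1 + (q + 1 - 1) = j + 1 + (q + 1) - 1 by omega]

theorem sum_wittMono_x (c : Fin 3 × Fin 3 × Fin 2 → k) (l : Fin 2) :
    (∑ t, c t • wittMono k t.1 t.2.1 t.2.2 : WittAlgebra 3 2 k) (x 3 2 k l) =
      ∑ i : Fin 3, ∑ j : Fin 3, c (i, j, l) • mono k i j := by
  have h : ∀ s : Finset (Fin 3 × Fin 3 × Fin 2),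
      (∑ t ∈ s, c t • wittMono k t.1 t.2.1 t.2.2 : WittAlgebra 3 2 k) (x 3 2 k l) =
        ∑ t ∈ s, c t • if t.2.2 = l then mono k t.1 t.2.1 else 0 := by
    intro s
    induction s using Finset.induction_on with
    | empty => simp
    | insert a s ha ih =>
      rw [Finset.sum_insert ha, Finset.sum_insert ha, Derivation.add_apply, ih,
        Derivation.smul_apply, wittMono_x]
  rw [h, Fintype.sum_prod_type]
  refine Finset.sum_congr rfl fun i _ => ?_
  rw [Fintype.sum_prod_type]
  refine Finset.sum_congr rfl fun j _ => ?_
  rw [Finset.sum_eq_single l]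
  · simp
  · intro d _ hd
    simp [hd]
  · exact fun h => absurd (Finset.mem_univ l) h

theorem mem_conformalHamiltonian_iff {D : WittAlgebra 3 2 k} :
    D ∈ conformalHamiltonian 3 k ↔ ∃ c : k, divergence D = c • 1 := by
  have htwo : (2 : TruncPoly 3 2 k) = (2 : k) • 1 := by
    rw [two_smul, one_add_one_eq_two]
  constructor
  · intro h
    obtain ⟨A, hA, B, hB, rfl⟩ := Submodule.mem_sup.1 h
    obtain ⟨c, rfl⟩ := Submodule.mem_span_singleton.1 hB
    refine ⟨c * 2, ?_⟩
    rw [divergence_add, divergence_smul, divergence_degreeD, (mem_hamiltonian 3 k).1 hA, zero_add,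
      htwo, smul_smul]
  · rintro ⟨c, hc⟩
    have h : D + (-(c / 2)) • degreeD 3 k ∈ hamiltonian 3 k := by
      rw [mem_hamiltonian, divergence_add, divergence_smul,
        divergence_degreeD, hc, htwo, smul_smul, ← add_smul, neg_mul,
        div_mul_cancel₀ c two_ne_zero_of_charP_three, add_neg_cancel, zero_smul]
    have h' := Submodule.add_mem_sup h ((Submodule.mem_span_singleton (y := degreeD 3 k)).2 ⟨c / 2, rfl⟩)
    rwa [add_assoc, ← add_smul, neg_add_cancel, zero_smul, add_zero] at h'

/-- A homomorphism to `W(2; 1)` whose image contains `H(2; 1)` vanishes on every solvable ideal,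
as the image of a nonzero term of the derived series is not abelian. -/
theorem le_ker_of_isSolvable {S : Type*} [LieRing S] [LieAlgebra k S]
    (f : S →ₗ⁅k⁆ WittAlgebra 3 2 k) (hf : ∀ D ∈ hamiltonian 3 k, ∃ y, f y = D) (I : LieIdeal k S)
    [hI : LieAlgebra.IsSolvable I] : I ≤ f.ker := by
  by_contra hle
  have key : ∀ n, ∃ y ∈ LieAlgebra.derivedSeriesOfIdeal k S n I, f y ≠ 0 := by
    intro n
    induction n with
    | zero =>
      obtain ⟨y, hy, hy'⟩ := SetLike.not_le_iff_exists.1 hle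
      exact ⟨y, hy, fun h => hy' (LieHom.mem_ker.2 h)⟩
    | succ n ih =>
      obtain ⟨y, hy, hne⟩ := ih
      let J := (LieAlgebra.derivedSeriesOfIdeal k S n I).toSubmodule.map (f : S →ₗ[k] WittAlgebra 3 2 k)
      have hJ : J ≠ ⊥ := fun h => hne (by
        have : f y ∈ J := ⟨y, hy, rfl⟩
        rwa [h, Submodule.mem_bot] at this)
      obtain ⟨_, ⟨u, hu, rfl⟩, _, ⟨v, hv, rfl⟩, huv⟩ := exists_lie_ne_zero_of_stable hJ (by
        rintro E hE _ ⟨v, hv, rfl⟩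
        obtain ⟨u, rfl⟩ := hf E hE
        exact ⟨⁅u, v⁆, lie_mem_right k S _ u v hv, f.map_lie u v⟩)
      refine ⟨⁅u, v⁆, ?_, fun h => huv ?_⟩
      · rw [LieAlgebra.derivedSeriesOfIdeal_succ]
        exact LieSubmodule.lie_mem_lie hu hv
      · exact (f.map_lie u v).symm.trans h
  obtain ⟨n, hn⟩ := (LieAlgebra.isSolvable_iff k I).1 hI
  rw [LieIdeal.derivedSeries_eq_bot_iff] at hn
  obtain ⟨y, hy, hne⟩ := key n
  rw [hn, LieSubmodule.mem_bot] at hy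
  exact hne (by rw [hy, map_zero])

theorem radical_eq_ker {S : Type*} [LieRing S] [LieAlgebra k S]
    (f : S →ₗ⁅k⁆ WittAlgebra 3 2 k) (hf : ∀ D ∈ hamiltonian 3 k, ∃ y, f y = D)
    (hker : ∀ x y, f x = 0 → f y = 0 → ⁅x, y⁆ = 0) : LieAlgebra.radical k S = f.ker := by
  refine le_antisymm (sSup_le fun I hI => ?_) (le_sSup ?_)
  · have : LieAlgebra.IsSolvable I := hI
    exact le_ker_of_isSolvable f hf I
  · have : IsLieAbelian f.ker := ⟨fun x y => Subtype.ext
      (hker x y (LieHom.mem_ker.1 x.2) (LieHom.mem_ker.1 y.2))⟩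
    change LieAlgebra.IsSolvable f.ker
    infer_instance

end Twisted

/-! ### The homomorphism from the normaliser of `A` to `W(2; 1)` -/

section Projection

open F4 TruncPoly

variable {k L : Type*} [Field k] [CharP k 3] [LieRing L] [LieAlgebra k L]
  {b : Module.Basis (Fin 52) k L}

/-- The index of the basis vector that corresponds to the monomial `x₁ⁱ x₂ʲ`, if `3 i + j < 8`. -/
def monoIdx (s : Fin 3 × Fin 3) : Fin 52 := ⟨3 * s.1 + s.2, by omega⟩

/-- The index of the basis vector that corresponds to the derivation `x₁ⁱ x₂ʲ ∂_{d + 1}`. -/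
def wittIdx (t : Fin 3 × Fin 3 × Fin 2) : Fin 52 := ⟨8 + 2 * (3 * t.1 + t.2.1) + t.2.2, by omega⟩

theorem monoIdx_injective : Function.Injective monoIdx := by
  rintro ⟨i, j⟩ ⟨p, q⟩ h
  simp only [monoIdx, Fin.mk.injEq] at h
  ext <;> simp only <;> omega

theorem wittIdx_injective : Function.Injective wittIdx := by
  rintro ⟨i, j, d⟩ ⟨p, q, l⟩ h
  simp only [wittIdx, Fin.mk.injEq] at h
  ext <;> simp only <;> omega

theorem exists_monoIdx {n : Fin 52} (hn : (n : ℕ) < 8) : ∃ s, monoIdx s = n :=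
  ⟨(⟨n / 3, by omega⟩, ⟨n % 3, by omega⟩), Fin.ext (by simp only [monoIdx]; omega)⟩

theorem exists_wittIdx {n : Fin 52} (h8 : 8 ≤ (n : ℕ)) (h26 : (n : ℕ) < 26) :
    ∃ t, wittIdx t = n :=
  ⟨(⟨(n / 2 - 4) / 3, by omega⟩, ⟨(n / 2 - 4) % 3, by omega⟩, ⟨n % 2, by omega⟩),
    Fin.ext (by simp only [wittIdx]; omega)⟩

/-- The linear map that sends the basis vectors of `A` to the monomials. -/
noncomputable def toPoly (b : Module.Basis (Fin 52) k L) : L →ₗ[k] TruncPoly 3 2 k :=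
  ∑ s, (b.coord (monoIdx s)).smulRight (mono k s.1 s.2)

/-- The linear map that sends `b_i`, for `8 ≤ i < 26`, to the derivations `x₁ⁱ x₂ʲ ∂_d`, and the
other basis vectors to zero. -/
noncomputable def toWitt (b : Module.Basis (Fin 52) k L) : L →ₗ[k] WittAlgebra 3 2 k :=
  ∑ t, (b.coord (wittIdx t)).smulRight (wittMono k t.1 t.2.1 t.2.2)

omit [CharP k 3] in
theorem toPoly_apply (x : L) :
    toPoly b x = ∑ s, b.repr x (monoIdx s) • mono k s.1 s.2 := by
  simp [toPoly]

theorem toWitt_apply (x : L) :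
    toWitt b x = ∑ t, b.repr x (wittIdx t) • wittMono k t.1 t.2.1 t.2.2 := by
  simp [toWitt]

omit [CharP k 3] in
theorem toPoly_basis (s : Fin 3 × Fin 3) : toPoly b (b (monoIdx s)) = mono k s.1 s.2 := by
  rw [toPoly_apply, Finset.sum_eq_single s]
  · simp
  · intro t _ ht
    simp [monoIdx_injective.ne ht.symm]
  · exact fun h => absurd (Finset.mem_univ s) h

theorem toWitt_basis (t : Fin 3 × Fin 3 × Fin 2) :
    toWitt b (b (wittIdx t)) = wittMono k t.1 t.2.1 t.2.2 := by
  rw [toWitt_apply, Finset.sum_eq_single t]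
  · simp
  · intro s _ hs
    simp [wittIdx_injective.ne hs.symm]
  · exact fun h => absurd (Finset.mem_univ t) h

theorem toWitt_eq_zero {x : L} (hx : x ∈ initialSpan b 8) : toWitt b x = 0 := by
  rw [toWitt_apply]
  refine Finset.sum_eq_zero fun t _ => ?_
  rw [hx _ (by simp only [wittIdx]; omega), zero_smul]

theorem mem_of_toWitt_eq_zero {x : L} (hx : x ∈ initialSpan b 26) (h : toWitt b x = 0) :
    x ∈ initialSpan b 8 := by
  intro n hn
  by_cases h26 : 26 ≤ (n : ℕ)
  · exact hx n h26
  obtain ⟨⟨i, j, d⟩, rfl⟩ := exists_wittIdx hn (not_le.1 h26)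
  rw [toWitt_apply] at h
  have h' := DFunLike.congr_fun h (TruncPoly.x 3 2 k d)
  rw [sum_wittMono_x (fun t => b.repr x (wittIdx t))] at h'
  exact mono_linearIndependent h' i j

omit [CharP k 3] in
theorem eq_zero_of_toPoly_eq_zero {x : L} (hx : x ∈ initialSpan b 8) (h : toPoly b x = 0) :
    x = 0 := by
  rw [toPoly_apply, Fintype.sum_prod_type] at h
  have h' := mono_linearIndependent (c := fun i j => b.repr x (monoIdx (i, j))) h
  refine b.ext_elem fun n => ?_
  rw [map_zero, Finsupp.zero_apply]
  by_cases hn : 8 ≤ (n : ℕ)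
  · exact hx n hn
  obtain ⟨⟨i, j⟩, rfl⟩ := exists_monoIdx (not_le.1 hn)
  exact h' i j

theorem exists_toWitt_eq (D : WittAlgebra 3 2 k) : ∃ x ∈ initialSpan b 26, toWitt b x = D := by
  choose c hc using fun d => exists_eq_sum_mono (D (x 3 2 k d))
  refine ⟨∑ t : Fin 3 × Fin 3 × Fin 2, c t.2.2 t.1 t.2.1 • b (wittIdx t),
    sum_mem fun t _ => Submodule.smul_mem _ _
      (basis_mem_initialSpan.2 (by simp only [wittIdx]; omega)), ?_⟩
  rw [map_sum]
  refine derivation_ext fun l => ?_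
  rw [hc l, ← sum_wittMono_x (fun t => c t.2.2 t.1 t.2.1)]
  simp only [map_smul, toWitt_basis]

namespace IsAdapted

theorem toPoly_lie_basis (hb : IsAdapted b) {i a : Fin 52} (hi : (i : ℕ) < 26) (ha : (a : ℕ) < 8) :
    toPoly b ⁅b i, b a⁆ = twist k (toWitt b (b i)) (toPoly b (b a)) := by
  by_cases h8 : (i : ℕ) < 8
  · rw [hb.lie_eq_zero (basis_mem_initialSpan.2 h8) (basis_mem_initialSpan.2 ha),
      toWitt_eq_zero (basis_mem_initialSpan.2 h8)]
    simp
  obtain ⟨⟨m, n, d⟩, rfl⟩ := exists_wittIdx (not_lt.1 h8) hi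
  obtain ⟨⟨p, q⟩, rfl⟩ := exists_monoIdx ha
  rw [toWitt_basis, toPoly_basis, toPoly_apply]
  simp only [hb.repr_lie, structConst_eq hi ha, if_neg h8]
  -- the sum has at most one nonzero term
  have hsum : ∀ (c : k) (u v : ℕ), (∑ s : Fin 3 × Fin 3,
      (if u < 3 ∧ v < 3 ∧ 3 * (s.1 : ℕ) + s.2 = 3 * u + v then c else 0) • mono k s.1 s.2) =
        c • mono k u v := by
    intro c u v
    by_cases huv : u < 3 ∧ v < 3
    · rw [Finset.sum_eq_single (⟨u, huv.1⟩, ⟨v, huv.2⟩)]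
      · rw [if_pos ⟨huv.1, huv.2, rfl⟩]
      · rintro ⟨u', v'⟩ _ hne
        rw [if_neg, zero_smul]
        rintro ⟨-, -, h⟩
        refine hne ?_
        simp only at h
        ext <;> simp only <;> omega
      · exact fun h => absurd (Finset.mem_univ _) h
    · rw [mono_eq_zero (by omega), smul_zero]
      refine Finset.sum_eq_zero fun s _ => ?_
      rw [if_neg fun h => huv ⟨h.1, h.2.1⟩, zero_smul]
  have hm : ((8 + 2 * (3 * (m : ℕ) + n) + d) / 2 - 4) / 3 = m := by omega
  have hn : ((8 + 2 * (3 * (m : ℕ) + n) + d) / 2 - 4) % 3 = n := by omega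
  have hd : (8 + 2 * (3 * (m : ℕ) + n) + d) % 2 = d := by omega
  have hp : (3 * (p : ℕ) + q) / 3 = p := by omega
  have hq : (3 * (p : ℕ) + q) % 3 = q := by omega
  simp only [twistedCoeff, wittIdx, monoIdx, hm, hn, hd, hp, hq]
  fin_cases d
  · rw [Fin.zero_eta, twist_wittMono_zero, ← hsum]
    refine Finset.sum_congr rfl fun s _ => ?_
    simp
  · rw [Fin.mk_one, twist_wittMono_one, ← hsum]
    refine Finset.sum_congr rfl fun s _ => ?_
    simp

/-- The normaliser of `A` acts on `A` through the twisted action of `W(2; 1)`. -/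
theorem toPoly_lie (hb : IsAdapted b) {x y : L} (hx : x ∈ initialSpan b 26)
    (hy : y ∈ initialSpan b 8) : toPoly b ⁅x, y⁆ = twist k (toWitt b x) (toPoly b y) := by
  refine induction_initialSpan (f := toPoly b ∘ₗ (LieAlgebra.ad k L x : L →ₗ[k] L))
    (g := twist k (toWitt b x) ∘ₗ toPoly b) (fun a ha => ?_) hy
  change toPoly b ⁅x, b a⁆ = twist k (toWitt b x) (toPoly b (b a))
  rw [← lie_skew, map_neg]
  refine induction_initialSpan (f := -(toPoly b ∘ₗ (LieAlgebra.ad k L (b a) : L →ₗ[k] L)))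
    (g := (twist k).flip (toPoly b (b a)) ∘ₗ toWitt b) (fun i hi => ?_) hx
  change -toPoly b ⁅b a, b i⁆ = twist k (toWitt b (b i)) (toPoly b (b a))
  rw [← map_neg, lie_skew, hb.toPoly_lie_basis hi ha]

theorem lie_mem_initialSpan (hb : IsAdapted b) {x y : L} (hx : x ∈ initialSpan b 26)
    (hy : y ∈ initialSpan b 26) : ⁅x, y⁆ ∈ initialSpan b 26 := by
  rw [← hb.normalizerOf_eq] at hx hy ⊢
  exact (normalizerOf (initialSpan b 8)).lie_mem hx hy

/-- `toWitt` is a homomorphism on the normaliser of `A`, because the twisted action is faithful. -/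
theorem toWitt_lie (hb : IsAdapted b) {x y : L} (hx : x ∈ initialSpan b 26)
    (hy : y ∈ initialSpan b 26) : toWitt b ⁅x, y⁆ = ⁅toWitt b x, toWitt b y⁆ := by
  have key : ∀ s, (monoIdx s : ℕ) < 8 → twist k (toWitt b ⁅x, y⁆) (mono k s.1 s.2) =
      twist k ⁅toWitt b x, toWitt b y⁆ (mono k s.1 s.2) := by
    intro s hs
    have ha : b (monoIdx s) ∈ initialSpan b 8 := basis_mem_initialSpan.2 hs
    rw [← toPoly_basis (b := b), ← hb.toPoly_lie (hb.lie_mem_initialSpan hx hy) ha, twist_lie,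
      ← hb.toPoly_lie hx ha, ← hb.toPoly_lie hy ha, ← hb.toPoly_lie hx (hb.lie_mem hy ha),
      ← hb.toPoly_lie hy (hb.lie_mem hx ha), ← map_sub, lie_lie]
  have h00 := key (0, 0) (by decide)
  have h10 := key (1, 0) (by decide)
  have h01 := key (0, 1) (by decide)
  simp only [Fin.coe_ofNat_eq_mod, Nat.zero_mod, Nat.one_mod, mono_zero_zero,
    mono_one_zero, mono_zero_one] at h00 h10 h01
  exact eq_of_twist_eq h00 (Fin.forall_fin_two.2 ⟨h10, h01⟩)

omit [CharP k 3] in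
theorem toPoly_zero : toPoly b (b 0) = 1 := by
  exact (toPoly_basis (b := b) (0, 0)).trans mono_zero_zero

/-- The bracket of `x` with `b₀` corresponds to the divergence of the image of `x`. -/
theorem toPoly_lie_zero (hb : IsAdapted b) {x : L} (hx : x ∈ initialSpan b 26) :
    toPoly b ⁅x, b 0⁆ = divergence (toWitt b x) := by
  rw [hb.toPoly_lie hx (basis_mem_initialSpan.2 (by simp)), toPoly_zero, twist_one]

theorem mem_centralizerOf_iff (hb : IsAdapted b) {x : L} : x ∈ centralizerOf k (b 0) ↔
    x ∈ initialSpan b 26 ∧ toWitt b x ∈ hamiltonian 3 k := by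
  have h0 : b 0 ∈ initialSpan b 8 := basis_mem_initialSpan.2 (by simp)
  change ⁅x, b 0⁆ = 0 ↔ _
  constructor
  · intro h
    have hx : x ∈ initialSpan b 26 := hb.mem_of_lie_mem (by
      rw [← lie_skew, h, neg_zero]; exact zero_mem _)
    refine ⟨hx, ?_⟩
    rw [mem_hamiltonian, ← hb.toPoly_lie_zero hx, h, map_zero]
  · rintro ⟨hx, h⟩
    refine eq_zero_of_toPoly_eq_zero (hb.lie_mem hx h0) ?_
    rw [hb.toPoly_lie_zero hx, (mem_hamiltonian 3 k).1 h]

theorem mem_normalizerOf_iff (hb : IsAdapted b) {x : L} :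
    x ∈ normalizerOf (Submodule.span k {b 0}) ↔
      x ∈ initialSpan b 26 ∧ toWitt b x ∈ conformalHamiltonian 3 k := by
  have h0 : b 0 ∈ initialSpan b 8 := basis_mem_initialSpan.2 (by simp)
  have hiff : x ∈ normalizerOf (Submodule.span k {b 0}) ↔ ∃ c : k, c • b 0 = ⁅x, b 0⁆ := by
    rw [← Submodule.mem_span_singleton]
    refine ⟨fun h => h _ (Submodule.mem_span_singleton_self _), fun h v hv => ?_⟩
    obtain ⟨c, rfl⟩ := Submodule.mem_span_singleton.1 hv
    rw [lie_smul]
    exact Submodule.smul_mem _ c h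
  rw [hiff, mem_conformalHamiltonian_iff]
  constructor
  · rintro ⟨c, hc⟩
    have hx : x ∈ initialSpan b 26 := hb.mem_of_lie_mem (by
      rw [← lie_skew, ← hc]; exact neg_mem (Submodule.smul_mem _ c h0))
    exact ⟨hx, c, by rw [← hb.toPoly_lie_zero hx, ← hc, map_smul, toPoly_zero]⟩
  · rintro ⟨hx, c, hc⟩
    refine ⟨c, (sub_eq_zero.1 (eq_zero_of_toPoly_eq_zero
      (sub_mem (hb.lie_mem hx h0) (Submodule.smul_mem _ c h0)) ?_)).symm⟩
    rw [map_sub, hb.toPoly_lie_zero hx, hc, map_smul, toPoly_zero, sub_self]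

/-! ### Quotients by the radical -/

/-- The restriction of `toWitt` to a subalgebra of the normaliser of `A`. -/
noncomputable def wittHom (hb : IsAdapted b) {S : LieSubalgebra k L}
    (hS : ∀ x ∈ S, x ∈ initialSpan b 26) : S →ₗ⁅k⁆ WittAlgebra 3 2 k where
  toFun x := toWitt b x
  map_add' x y := map_add (toWitt b) (x : L) (y : L)
  map_smul' c x := map_smul (toWitt b) c (x : L)
  map_lie' {x y} := by
    have h := hb.toWitt_lie (hS x x.2) (hS y y.2)
    exact h

theorem wittHom_apply (hb : IsAdapted b) {S : LieSubalgebra k L}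
    (hS : ∀ x ∈ S, x ∈ initialSpan b 26) (x : S) : hb.wittHom hS x = toWitt b x := rfl

/-- If `S` is the preimage of a subalgebra `T ⊇ H(2; 1)` of `W(2; 1)`, then `A` is the radical of
`S`, and the quotient is `T`. -/
theorem radical_of_preimage (hb : IsAdapted b) {S : LieSubalgebra k L}
    {T : LieSubalgebra k (WittAlgebra 3 2 k)}
    (hST : ∀ x, x ∈ S ↔ x ∈ initialSpan b 26 ∧ toWitt b x ∈ T) (hT : hamiltonian 3 k ≤ T) :
    initialSpan b 8 = radicalOf S ∧ Nonempty ((S ⧸ LieAlgebra.radical k S) ≃ₗ⁅k⁆ T) := by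
  have hS : ∀ x ∈ S, x ∈ initialSpan b 26 := fun x hx => ((hST x).1 hx).1
  have hAS : ∀ x ∈ initialSpan b 8, x ∈ S := fun x hx => (hST x).2
    ⟨initialSpan_mono (by omega) hx, by rw [toWitt_eq_zero hx]; exact T.zero_mem⟩
  obtain ⟨f, hf⟩ : ∃ f : S →ₗ⁅k⁆ WittAlgebra 3 2 k, ∀ x, f x = toWitt b x :=
    ⟨hb.wittHom hS, hb.wittHom_apply hS⟩
  have hmem : ∀ x : S, f x = 0 ↔ (x : L) ∈ initialSpan b 8 := fun x =>
    ⟨fun h => mem_of_toWitt_eq_zero (hS x x.2) ((hf x).symm.trans h),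
      fun h => (hf x).trans (toWitt_eq_zero h)⟩
  have hrange : f.range = T := by
    ext D
    rw [LieHom.mem_range]
    constructor
    · rintro ⟨x, rfl⟩
      rw [hf]
      exact ((hST x).1 x.2).2
    · intro hD
      obtain ⟨x, hx, rfl⟩ := exists_toWitt_eq (b := b) D
      exact ⟨⟨x, (hST x).2 ⟨hx, hD⟩⟩, hf _⟩
  have hrad : LieAlgebra.radical k S = f.ker := by
    refine radical_eq_ker f (fun D hD => ?_) fun x y hx hy => Subtype.ext
      (hb.lie_eq_zero ((hmem x).1 hx) ((hmem y).1 hy))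
    have : D ∈ f.range := by rw [hrange]; exact hT hD
    exact this
  constructor
  · ext x
    rw [radicalOf, hrad, Submodule.mem_map]
    constructor
    · intro hx
      exact ⟨⟨x, hAS x hx⟩, LieHom.mem_ker.2 ((hmem _).2 hx), rfl⟩
    · rintro ⟨y, hy, rfl⟩
      exact (hmem y).1 (LieHom.mem_ker.1 hy)
  · rw [hrad, ← hrange]
    exact ⟨f.quotKerEquivRange⟩

end IsAdapted

end Projection

theorem mainTheorem5 (k : Type*) [Field k] [IsAlgClosed k] [CharP k 3]
    (e : LieF4 k) (he : e ∈ LieF4.orbitA2tA1 k)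
    (ge ne w : LieSubalgebra k (LieF4 k)) (A : Submodule k (LieF4 k))
    (hge : ge = centralizerOf k e)
    (hne : ne = normalizerOf (Submodule.span k {e}))
    (hA : A = radicalOf ge)
    (hw : w = normalizerOf A) :
    -- `A` is abelian of dimension `8`
    ((∀ x ∈ A, ∀ y ∈ A, ⁅x, y⁆ = 0) ∧ Module.finrank k A = 8) ∧
    -- (a) `A = rad(g_e)` by definition, and `g_e / A ≅ H(2;1)`
    Nonempty ((ge ⧸ LieAlgebra.radical k ge) ≃ₗ⁅k⁆ hamiltonian 3 k) ∧
    -- (b) `A = rad(n_e)` and `n_e / A ≅ CH(2;1)`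
    (A = radicalOf ne ∧
      Nonempty ((ne ⧸ LieAlgebra.radical k ne) ≃ₗ⁅k⁆ conformalHamiltonian 3 k)) ∧
    -- (c) `A = rad(w)` and `w / A ≅ W(2;1)`
    (A = radicalOf w ∧
      Nonempty ((w ⧸ LieAlgebra.radical k w) ≃ₗ⁅k⁆ WittAlgebra 3 2 k)) ∧
    -- (d) `w` is a maximal subalgebra, and it is not parabolic
    IsCoatom w ∧ ¬ LieF4.IsParabolic w := by
  obtain ⟨b, hb, rfl⟩ := LieF4.exists_isAdapted he
  have hcent := hb.radical_of_preimage (S := ge) (T := hamiltonian 3 k)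
    (fun x => by rw [hge]; exact hb.mem_centralizerOf_iff) le_rfl
  have hnorm := hb.radical_of_preimage (S := ne) (T := conformalHamiltonian 3 k)
    (fun x => by rw [hne]; exact hb.mem_normalizerOf_iff) (fun D hD => Submodule.mem_sup_left hD)
  have hA' : A = initialSpan b 8 := hA.trans hcent.1.symm
  have hwspan : w.toSubmodule = initialSpan b 26 := by rw [hw, hA', hb.normalizerOf_eq]
  have hwitt := hb.radical_of_preimage (S := w) (T := ⊤)
    (fun x => by
      rw [← hwspan]
      exact ⟨fun h => ⟨h, LieSubalgebra.mem_top _⟩, fun h => h.1⟩) le_top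
  refine ⟨⟨?_, ?_⟩, hcent.2, ⟨hA'.trans hnorm.1, hnorm.2⟩, ⟨hA'.trans hwitt.1, ?_⟩,
    hb.isCoatom hwspan, fun hp => ?_⟩
  · rw [hA']
    exact fun x hx y hy => hb.lie_eq_zero hx hy
  · rw [hA', finrank_initialSpan (by omega)]
  · exact hwitt.2.map fun f => f.trans LieSubalgebra.topEquiv
  · have h := LieF4.le_finrank_of_isParabolic hp
    have h' : Module.finrank k w = 26 := by
      change Module.finrank k w.toSubmodule = 26
      rw [hwspan, finrank_initialSpan (by omega)]
    omega
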